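/- Let $G=(V,E)$ be a directed acyclic graph with $V=\{v_1,\dots,v_n\}$, $m=|E|$. For every $i$ let $D_i=(v_{j_1},\dots,v_{j_{d_i}})$ be the list (without repetitions) of the out-neighbours of $v_i$, and let $d_i=|D_i|$. Let $L$ be the list of (indices of) sinks, i.e. of the vertices with $d_i=0$, and $\hat n=n-|L|$. The number $n$, the out-degrees $d_i$ and the list of sources (vertices of in-degree $0$) are known; the entries of the arrays $D_i$ are accessed through a quantum oracle $|i,j\rangle|z\rangle|w\rangle\mapsto|i,j\rangle|z+D_i[j] \bmod n\rangle|w\rangle$. Algorithms are classical algorithms that may run quantum query subroutines (unitaries independent of the entries of the arrays, alternating with oracle calls, with a measurement at the end). Running time means the number of queries. A procedure $\mathrm{FirstOneSearch}'(D_i,start)$, for a given set of visited vertices, is to return the minimal index $z>start$ such that $v_{j_z}$ is not visited and $d_{j_z}>0$, or $\mathrm{NULL}$ if there is no such index. Given such a procedure, $\mathrm{TopSort}(G)$ starts with no visited vertices and the empty list $order$, and for each source $v_i$ that is not yet visited calls $\mathrm{TopSortDFS}(i)$. The procedure $\mathrm{TopSortDFS}(i)$ marks $v_i$ as visited; if $d_i>0$,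 it sets $z\gets\mathrm{FirstOneSearch}'(D_i,0)$, and while $z\neq\mathrm{NULL}$ it calls $\mathrm{TopSortDFS}(j_z)$ and sets $z\gets\mathrm{FirstOneSearch}'(D_i,z)$; after the loop it adds $i$ to the top of $order$. The result is the enumeration of the vertices given by $order$ followed by $L$. It is correct if it lists every vertex exactly once, every edge leads from an earlier to a later vertex, and the last $|L|$ vertices are sinks. Then $\mathrm{FirstOneSearch}'$ can be implemented in this quantum query model so that it only returns indices $z>start$ of unvisited non-sinks, its running time is $O(\sqrt{z-start}\,\log\hat n)$ on every execution ($z$ being the returned index, with $z=d_i$ if $\mathrm{NULL}$ is returned), its error probability is at most $1/\hat n^2$, and $\mathrm{TopSort}(G)$ with this implementation has the following properties, with absolute constants in the $O$-bounds: on every execution its running time is $O(\sqrt{\hat n m}\,\log\hat n)$, and the probability that its result is not correct is at most $0.1$ and at most $1/\hat n$. (When $\hat n=0$ the bounds $1/\hat n^2$ and $1/\hat n$ are understood as no restriction.) -/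

import Mathlib

open scoped ENNReal

noncomputable section

namespace QTopSort

/-! ### Graphs given by adjacency arrays -/

/-- A directed acyclic graph on the vertices `Fin n`, in the adjacency list model: `d i` is the
out-degree of the vertex `i`, and the array `D_i` of its out-neighbours is
`nbr i 0, …, nbr i (d i - 1)`, without repetitions. Acyclicity excludes loops and pairs of opposite
edges. The number `n` and the out-degrees `d` are kept outside the structure: they are known to an
algorithm, while the entries `nbr i j` are the input that has to be queried. -/
structure AdjDAG (n : ℕ) (d : Fin n → ℕ) where
  nbr : (i : Fin n) → Fin (d i) → Fin n
  nbr_injective : ∀ i, Function.Injective (nbr i)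
  acyclic : ∀ v, ¬ Relation.TransGen (fun u w => ∃ j, nbr u j = w) v v

/-- `(u, v)` is an edge. -/
def AdjDAG.Edge {n : ℕ} {d : Fin n → ℕ} (G : AdjDAG n d) (u v : Fin n) : Prop :=
  ∃ j, G.nbr u j = v

instance {n : ℕ} {d : Fin n → ℕ} (G : AdjDAG n d) (u v : Fin n) : Decidable (G.Edge u v) :=
  inferInstanceAs (Decidable (∃ j, G.nbr u j = v))

/-- The number `m = |E|` of edges. -/
def AdjDAG.numEdges {n : ℕ} {d : Fin n → ℕ} (G : AdjDAG n d) : ℕ :=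
  (Finset.univ.filter fun e : Fin n × Fin n => G.Edge e.1 e.2).card

/-- The list `L` of sinks (vertices of out-degree `0`). -/
def sinks {n : ℕ} (d : Fin n → ℕ) : List (Fin n) :=
  (List.finRange n).filter fun i => d i = 0

/-- `n - |L|`, the number of vertices that are not sinks. -/
def numNonSinks {n : ℕ} (d : Fin n → ℕ) : ℕ := n - (sinks d).length

/-- The list of sources (vertices of in-degree `0`). -/
def AdjDAG.sources {n : ℕ} {d : Fin n → ℕ} (G : AdjDAG n d) : List (Fin n) :=
  (List.finRange n).filter fun v => ∀ u, ¬ G.Edge u v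

/-- The enumeration `l` of the vertices makes the DAG ordered: every vertex is listed exactly once,
every edge leads from an earlier to a later vertex, and the last `|L|` vertices are sinks. -/
structure AdjDAG.IsOrderedBy {n : ℕ} {d : Fin n → ℕ} (G : AdjDAG n d) (l : List (Fin n)) :
    Prop where
  perm : l.Perm (List.finRange n)
  topological : ∀ u v, G.Edge u v → l.idxOf u < l.idxOf v
  sinks_last : ∀ (r : ℕ) (hr : r < l.length), numNonSinks d ≤ r → d l[r] = 0

/-! ### The quantum query model -/

/-- Computational basis `|i, j⟩ |z⟩ |w⟩`: the index `(i, j)` of an entry of the adjacency arrays, an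
answer register holding a vertex, and a work register of `W` basis states. -/
abbrev QBasis {n : ℕ} (d : Fin n → ℕ) (W : ℕ) : Type :=
  ((i : Fin n) × Fin (d i)) × Fin n × Fin W

theorem fin_add_sub {n : ℕ} (a b : Fin n) : a + b - b = a := by
  cases n with
  | zero => exact a.elim0
  | succ n => exact add_sub_cancel_right a b

theorem fin_sub_add {n : ℕ} (a b : Fin n) : a - b + b = a := by
  cases n with
  | zero => exact a.elim0
  | succ n => exact sub_add_cancel a b

/-- The query `|i, j⟩ |z⟩ |w⟩ ↦ |i, j⟩ |z + D_i[j] mod n⟩ |w⟩` on basis states. -/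
def AdjDAG.oracle {n : ℕ} {d : Fin n → ℕ} (G : AdjDAG n d) (W : ℕ) :
    Equiv.Perm (QBasis d W) where
  toFun b := (b.1, b.2.1 + G.nbr b.1.1 b.1.2, b.2.2)
  invFun b := (b.1, b.2.1 - G.nbr b.1.1 b.1.2, b.2.2)
  left_inv b := by simp [fin_add_sub]
  right_inv b := by simp [fin_sub_add]

/-- A quantum query subroutine: a work register, a number of queries, an initial basis state and
unitaries that do not depend on the entries of the adjacency arrays. -/
structure QuerySubroutine {n : ℕ} (d : Fin n → ℕ) where
  work : ℕ
  queries : ℕ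
  start : QBasis d work
  unitary : ℕ → Matrix.unitaryGroup (QBasis d work) ℂ

/-- The state `U_t O U_{t-1} O ⋯ O U_0 |start⟩` after `t` queries. -/
def QuerySubroutine.state {n : ℕ} {d : Fin n → ℕ} (Q : QuerySubroutine d) (G : AdjDAG n d) :
    ℕ → QBasis d Q.work → ℂ
  | 0 => (Q.unitary 0).1.mulVec (Pi.single Q.start 1)
  | t + 1 => (Q.unitary (t + 1)).1.mulVec fun b => Q.state G t ((G.oracle Q.work).symm b)

theorem sum_norm_sq_mulVec {ι : Type*} [Fintype ι] [DecidableEq ι]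
    (U : Matrix.unitaryGroup ι ℂ) (ψ : ι → ℂ) :
    ∑ b, ‖U.1.mulVec ψ b‖ ^ 2 = ∑ b, ‖ψ b‖ ^ 2 := by
  have key : ∀ φ : ι → ℂ, ((∑ b, ‖φ b‖ ^ 2 : ℝ) : ℂ) = dotProduct (star φ) φ := by
    intro φ
    simp only [dotProduct, Pi.star_apply, Complex.ofReal_sum, Complex.ofReal_pow]
    refine Finset.sum_congr rfl fun b _ => ?_
    exact (Complex.conj_mul' (φ b)).symm
  have h : dotProduct (star (U.1.mulVec ψ)) (U.1.mulVec ψ) = dotProduct (star ψ) ψ := by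
    rw [Matrix.star_mulVec, ← Matrix.dotProduct_mulVec, Matrix.mulVec_mulVec,
      ← Matrix.star_eq_conjTranspose, Matrix.UnitaryGroup.star_mul_self, Matrix.one_mulVec]
  have := (key _).trans (h.trans (key _).symm)
  exact_mod_cast this

theorem QuerySubroutine.sum_norm_sq_state {n : ℕ} {d : Fin n → ℕ} (Q : QuerySubroutine d)
    (G : AdjDAG n d) (t : ℕ) : ∑ b, ‖Q.state G t b‖ ^ 2 = 1 := by
  induction t with
  | zero =>
    rw [QuerySubroutine.state, sum_norm_sq_mulVec, Finset.sum_eq_single Q.start]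
    · simp
    · intro b _ hb
      simp [hb]
    · simp
  | succ t ih =>
    rw [QuerySubroutine.state, sum_norm_sq_mulVec, ← ih]
    exact Equiv.sum_comp (G.oracle Q.work).symm fun b => ‖Q.state G t b‖ ^ 2

/-- The outcome of measuring all registers in the computational basis after the last query. -/
def QuerySubroutine.outcome {n : ℕ} {d : Fin n → ℕ} (Q : QuerySubroutine d) (G : AdjDAG n d) :
    PMF (QBasis d Q.work) :=
  PMF.ofFintype (fun b => ENNReal.ofReal (‖Q.state G Q.queries b‖ ^ 2)) (by
    rw [← ENNReal.ofReal_sum_of_nonneg fun b _ => sq_nonneg _, Q.sum_norm_sq_state G,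
      ENNReal.ofReal_one])

/-- Classical algorithms with quantum query subroutines. A program returns a value, or reads one
entry `D_i[j]` (one query) and continues depending on it, or runs a quantum query subroutine and
continues depending on the measured outcome. A program depends on `n` and the out-degrees only; the
entries of the adjacency arrays are reached only through queries. -/
inductive Prog {n : ℕ} (d : Fin n → ℕ) (α : Type) : Type
  | ret (a : α) : Prog d α
  | read (i : Fin n) (j : Fin (d i)) (k : Fin n → Prog d α) : Prog d α
  | quantum (Q : QuerySubroutine d) (k : QBasis d Q.work → Prog d α) : Prog d α

/-- Sequential composition. -/
def Prog.bind {n : ℕ} {d : Fin n → ℕ} {α β : Type} : Prog d α → (α → Prog d β) → Prog d β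
  | .ret a, f => f a
  | .read i j k, f => .read i j fun v => (k v).bind f
  | .quantum Q k, f => .quantum Q fun b => (k b).bind f

/-- The joint distribution of the returned value and of the number of queries made when the program
is executed on the graph `G`. -/
def Prog.exec {n : ℕ} {d : Fin n → ℕ} {α : Type} (G : AdjDAG n d) : Prog d α → PMF (α × ℕ)
  | .ret a => PMF.pure (a, 0)
  | .read i j k => ((k (G.nbr i j)).exec G).map fun x => (x.1, x.2 + 1)
  | .quantum Q k =>
      (Q.outcome G).bind fun b => ((k b).exec G).map fun x => (x.1, x.2 + Q.queries)

/-- The running time, i.e. the number of queries, is at most `t a` on every execution, where `a` is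
the value that the execution returns. -/
def Prog.TimeLE {n : ℕ} {d : Fin n → ℕ} {α : Type} (p : Prog d α) (G : AdjDAG n d) (t : α → ℝ) :
    Prop :=
  ∀ x ∈ (p.exec G).support, (x.2 : ℝ) ≤ t x.1

/-- The probability that the returned value does not satisfy `good`. -/
def Prog.errorProb {n : ℕ} {d : Fin n → ℕ} {α : Type} (p : Prog d α) (G : AdjDAG n d)
    (good : α → Prop) : ℝ≥0∞ :=
  (p.exec G).toOuterMeasure {x | ¬ good x.1}

/-! ### First-one search -/

/-- The correct answer of the first-one search in `D_i` from `start`: the least position `z` with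
`start ≤ z` such that the vertex at position `z` of `D_i` is unvisited and is not a sink, or `none`.
Positions are counted from `0`, so `start` entries of the array are skipped. -/
def AdjDAG.firstOne {n : ℕ} {d : Fin n → ℕ} (G : AdjDAG n d) (visited : Finset (Fin n))
    (i : Fin n) (start : ℕ) : Option (Fin (d i)) :=
  (List.finRange (d i)).find? fun z =>
    start ≤ z.1 ∧ G.nbr i z ∉ visited ∧ 0 < d (G.nbr i z)

/-- The type of implementations of the first-one search, as programs of the query model. -/
abbrev FirstOneSearch : Type :=
  (n : ℕ) → (d : Fin n → ℕ) → (visited : Finset (Fin n)) → (i : Fin n) → (start : ℕ) →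
    Prog d (Option (Fin (d i)))

/-- The number of entries of `D_i` after the first `start` ones, up to and including the returned
one; all remaining entries if nothing was found. -/
def searchedLength {k : ℕ} (start : ℕ) : Option (Fin k) → ℝ
  | some z => (z.1 : ℝ) + 1 - start
  | none => (k : ℝ) - start

/-- `fos` is a bounded-error first-one search: a returned position always lies in the searched range
and holds an unvisited non-sink; with `nhat` the number of non-sinks, the running time is at most
`c * √(z - start) * log nhat`, and the probability that the answer is not the correct one is at most
`1 / nhat ^ 2`. -/
structure FirstOneSearch.IsCorrect (fos : FirstOneSearch) (c : ℝ) : Prop where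
  sound : ∀ (n : ℕ) (d : Fin n → ℕ) (G : AdjDAG n d) (visited : Finset (Fin n)) (i : Fin n)
    (start : ℕ), ∀ x ∈ ((fos n d visited i start).exec G).support, ∀ z, x.1 = some z →
      start ≤ z.1 ∧ G.nbr i z ∉ visited ∧ 0 < d (G.nbr i z)
  time : ∀ (n : ℕ) (d : Fin n → ℕ) (G : AdjDAG n d) (visited : Finset (Fin n)) (i : Fin n)
    (start : ℕ), (fos n d visited i start).TimeLE G fun o =>
      c * √(searchedLength start o) * Real.log (numNonSinks d)
  error : ∀ (n : ℕ) (d : Fin n → ℕ) (G : AdjDAG n d) (visited : Finset (Fin n)) (i : Fin n)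
    (start : ℕ), (fos n d visited i start).errorProb G (fun o => o = G.firstOne visited i start)
      ≤ 1 / (numNonSinks d : ℝ≥0∞) ^ 2

/-! ### The quantum topological sort -/

/-- The memory of the topological sort: the visited vertices and the list `order`. -/
structure SortState (n : ℕ) where
  visited : Finset (Fin n)
  order : List (Fin n)

/-- The while loop over the answers of the first-one search in `D_i`, starting at `start`;
`recurse` is the procedure called on each vertex found. The first argument bounds the number of
rounds and is there only to make the recursion well-founded. -/
def searchLoop (fos : FirstOneSearch) {n : ℕ} (d : Fin n → ℕ)
    (recurse : Fin n → SortState n → Prog d (SortState n)) (i : Fin n) :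
    ℕ → ℕ → SortState n → Prog d (SortState n)
  | 0, _, s => .ret s
  | fuel + 1, start, s => (fos n d s.visited i start).bind fun o =>
      match o with
      | none => .ret s
      | some z => .read i z fun v =>
          (recurse v s).bind fun s' => searchLoop fos d recurse i fuel (z.1 + 1) s'

/-- The procedure that processes the vertex `i`. The first argument bounds the depth of the
recursion and is there only to make it well-founded. -/
def topSortDFS (fos : FirstOneSearch) {n : ℕ} (d : Fin n → ℕ) :
    ℕ → Fin n → SortState n → Prog d (SortState n)
  | 0, _, s => .ret s
  | fuel + 1, i, s =>
      let s₁ : SortState n := ⟨insert i s.visited, s.order⟩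
      if 0 < d i then
        (searchLoop fos d (topSortDFS fos d fuel) i (d i + 1) 0 s₁).bind fun s₂ =>
          .ret ⟨s₂.visited, i :: s₂.order⟩
      else .ret s₁

/-- The loop over the list of sources. Along a path of a DAG there are at most `n` vertices, and a
first-one search from increasing positions of `D_i` finds at most `d i` vertices, so that the bounds
`n` on the depth of the recursion and `d i + 1` on the rounds of the while loop are not exceeded. -/
def sourceLoop (fos : FirstOneSearch) {n : ℕ} (d : Fin n → ℕ) :
    List (Fin n) → SortState n → Prog d (SortState n)
  | [], s => .ret s
  | i :: is, s =>
      if i ∈ s.visited then sourceLoop fos d is s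
      else (topSortDFS fos d n i s).bind fun s' => sourceLoop fos d is s'

/-- The quantum topological sort with the given list of sources. It returns the new enumeration of
the vertices: the list `order` followed by the list of sinks. -/
def topSort (fos : FirstOneSearch) {n : ℕ} (d : Fin n → ℕ) (sources : List (Fin n)) :
    Prog d (List (Fin n)) :=
  (sourceLoop fos d sources ⟨∅, []⟩).bind fun s => .ret (s.order ++ sinks d)

end QTopSort

end

open QTopSort
open scoped ENNReal

namespace QTopSort

/-! ### Executions of composed programs -/

section Calculus

variable {n : ℕ} {d : Fin n → ℕ} {α β : Type} (G : AdjDAG n d)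

theorem Prog.exec_bind (p : Prog d α) (f : α → Prog d β) :
    (p.bind f).exec G = (p.exec G).bind fun x =>
      ((f x.1).exec G).map fun y => (y.1, x.2 + y.2) := by
  induction p with
  | ret a =>
    simp only [Prog.bind, Prog.exec, PMF.pure_bind, zero_add, Prod.mk.eta]
    exact (PMF.map_id _).symm
  | read i j k ih =>
    simp only [Prog.bind, Prog.exec, ih, PMF.map_bind, PMF.bind_map, PMF.map_comp]
    congr 1
    funext x
    simp only [Function.comp_apply]
    congr 1
    funext y
    simp [add_right_comm]
  | quantum Q k ih =>
    simp only [Prog.bind, Prog.exec, ih, PMF.map_bind, PMF.bind_map, PMF.map_comp, PMF.bind_bind]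
    congr 1
    funext b
    congr 1
    funext x
    simp only [Function.comp_apply]
    congr 1
    funext y
    simp [add_right_comm]

theorem Prog.mem_support_ret {a : α} {x : α × ℕ} :
    x ∈ ((Prog.ret a : Prog d α).exec G).support ↔ x = (a, 0) := by
  simp [Prog.exec]

theorem Prog.mem_support_read {i : Fin n} {j : Fin (d i)} {k : Fin n → Prog d α} {x : α × ℕ} :
    x ∈ ((Prog.read i j k).exec G).support ↔
      ∃ y ∈ ((k (G.nbr i j)).exec G).support, x = (y.1, y.2 + 1) := by
  simp only [Prog.exec, PMF.mem_support_map_iff, eq_comm]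

theorem Prog.mem_support_quantum {Q : QuerySubroutine d} {k : QBasis d Q.work → Prog d α}
    {x : α × ℕ} (hx : x ∈ ((Prog.quantum Q k).exec G).support) :
    ∃ b, ∃ y ∈ ((k b).exec G).support, x = (y.1, y.2 + Q.queries) := by
  simp only [Prog.exec, PMF.mem_support_bind_iff, PMF.mem_support_map_iff] at hx
  obtain ⟨b, -, y, hy, rfl⟩ := hx
  exact ⟨b, y, hy, rfl⟩

theorem Prog.mem_support_bind {p : Prog d α} {f : α → Prog d β} {x : β × ℕ} :
    x ∈ ((p.bind f).exec G).support ↔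
      ∃ y ∈ (p.exec G).support, ∃ z ∈ ((f y.1).exec G).support, x = (z.1, y.2 + z.2) := by
  simp only [Prog.exec_bind, PMF.mem_support_bind_iff, PMF.mem_support_map_iff, eq_comm]

theorem Prog.errorProb_le_one (p : Prog d α) (good : α → Prop) : p.errorProb G good ≤ 1 := by
  rw [Prog.errorProb, PMF.toOuterMeasure_apply, ← (p.exec G).tsum_coe]
  exact ENNReal.tsum_le_tsum fun x => Set.indicator_le_self _ _ x

theorem Prog.errorProb_mono (p : Prog d α) {good good' : α → Prop} (h : ∀ a, good a → good' a) :
    p.errorProb G good' ≤ p.errorProb G good :=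
  MeasureTheory.measure_mono fun _ hx h' => hx (h _ h')

theorem Prog.errorProb_eq_zero (p : Prog d α) {good : α → Prop}
    (h : ∀ x ∈ (p.exec G).support, good x.1) : p.errorProb G good = 0 := by
  rw [Prog.errorProb, PMF.toOuterMeasure_apply_eq_zero_iff, Set.disjoint_left]
  exact fun x hx hx' => hx' (h x hx)

theorem Prog.errorProb_ret {a : α} {good : α → Prop} (h : good a) :
    (Prog.ret a : Prog d α).errorProb G good = 0 :=
  Prog.errorProb_eq_zero G _ fun x hx => by
    rw [Prog.mem_support_ret] at hx
    subst hx
    exact h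

theorem Prog.errorProb_read (i : Fin n) (j : Fin (d i)) (k : Fin n → Prog d α)
    (good : α → Prop) :
    (Prog.read i j k).errorProb G good = (k (G.nbr i j)).errorProb G good := by
  simp only [Prog.errorProb, Prog.exec, PMF.toOuterMeasure_map_apply]
  rfl

theorem Prog.errorProb_quantum (Q : QuerySubroutine d) (k : QBasis d Q.work → Prog d α)
    (good : α → Prop) :
    (Prog.quantum Q k).errorProb G good =
      ∑' b, Q.outcome G b * (k b).errorProb G good := by
  simp only [Prog.errorProb, Prog.exec, PMF.toOuterMeasure_bind_apply,
    PMF.toOuterMeasure_map_apply]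
  rfl

theorem Prog.errorProb_bind (p : Prog d α) (f : α → Prog d β) (good : β → Prop) :
    (p.bind f).errorProb G good = ∑' x, p.exec G x * (f x.1).errorProb G good := by
  simp only [Prog.errorProb, Prog.exec_bind, PMF.toOuterMeasure_bind_apply,
    PMF.toOuterMeasure_map_apply]
  rfl

theorem Prog.errorProb_bind_le (p : Prog d α) (f : α → Prog d β) (mid : α → Prop)
    (good : β → Prop) {δ ε : ℝ≥0∞} (hmid : ∀ a, mid a → (f a).errorProb G good ≤ δ)
    (hall : ∀ a, (f a).errorProb G good ≤ ε) :
    (p.bind f).errorProb G good ≤ δ + p.errorProb G mid * ε := by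
  classical
  rw [Prog.errorProb_bind, Prog.errorProb, PMF.toOuterMeasure_apply, ← ENNReal.tsum_mul_right]
  calc ∑' x, p.exec G x * (f x.1).errorProb G good
      ≤ ∑' x, (p.exec G x * δ + {x : α × ℕ | ¬ mid x.1}.indicator (p.exec G) x * ε) := by
        refine ENNReal.tsum_le_tsum fun x => ?_
        by_cases hx : mid x.1
        · exact le_add_right (mul_le_mul_right (hmid _ hx) _)
        · refine le_add_left ?_
          rw [Set.indicator_of_mem (by exact hx)]
          exact mul_le_mul_right (hall _) _
    _ = δ + ∑' x, {x : α × ℕ | ¬ mid x.1}.indicator (p.exec G) x * ε := by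
        rw [ENNReal.tsum_add, ENNReal.tsum_mul_right, PMF.tsum_coe, one_mul]

theorem Prog.errorProb_bind_le_add (p : Prog d α) (f : α → Prog d β) (mid : α → Prop)
    (good : β → Prop) {δ : ℝ≥0∞} (hmid : ∀ a, mid a → (f a).errorProb G good ≤ δ) :
    (p.bind f).errorProb G good ≤ δ + p.errorProb G mid := by
  simpa using Prog.errorProb_bind_le G p f mid good hmid fun a => (f a).errorProb_le_one G good

end Calculus

/-! ### Grover search in an adjacency array -/

section Reflection

variable {ι : Type*} [Fintype ι] [DecidableEq ι]

/-- The matrix `1 - 2 w wᴴ / (wᴴ w)` of the reflection in the hyperplane orthogonal to `w`. -/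
noncomputable def householder (w : ι → ℂ) : Matrix ι ι ℂ :=
  1 - (2 / (star w ⬝ᵥ w)) • Matrix.vecMulVec w (star w)

theorem householder_mulVec (w v : ι → ℂ) :
    (householder w).mulVec v = v - (2 / (star w ⬝ᵥ w) * (star w ⬝ᵥ v)) • w := by
  rw [householder, Matrix.sub_mulVec, Matrix.one_mulVec, Matrix.smul_mulVec,
    Matrix.vecMulVec_mulVec]
  ext x
  simp [mul_comm, mul_left_comm]

theorem householder_mem_unitaryGroup (w : ι → ℂ) :
    householder w ∈ Matrix.unitaryGroup ι ℂ := by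
  have hstar : star (star w ⬝ᵥ w) = star w ⬝ᵥ w := by
    rw [← Matrix.star_dotProduct_star, star_star, dotProduct_comm]
  have hself : star (householder w) = householder w := by
    rw [Matrix.star_eq_conjTranspose, householder, Matrix.conjTranspose_sub,
      Matrix.conjTranspose_one, Matrix.conjTranspose_smul, Matrix.conjTranspose_vecMulVec,
      star_star, star_div₀, hstar]
    simp
  rw [Matrix.mem_unitaryGroup_iff, hself]
  refine Matrix.toLin'.injective (LinearMap.ext fun v => ?_)
  rw [Matrix.toLin'_apply, Matrix.toLin'_apply, Matrix.one_mulVec, ← Matrix.mulVec_mulVec,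
    householder_mulVec, householder_mulVec]
  by_cases hw : star w ⬝ᵥ w = 0
  · simp [hw]
  · rw [dotProduct_sub, dotProduct_smul, smul_eq_mul]
    ext x
    simp only [Pi.sub_apply, Pi.smul_apply, smul_eq_mul]
    field_simp
    ring

/-- The unitary reflection in the hyperplane orthogonal to `w`. -/
noncomputable def reflectionUnitary (w : ι → ℂ) : Matrix.unitaryGroup ι ℂ :=
  ⟨householder w, householder_mem_unitaryGroup w⟩

theorem reflectionUnitary_sub_mulVec {u v : ι → ℂ} (hu : star u ⬝ᵥ u = 1)
    (hv : star v ⬝ᵥ v = 1) (huv : star v ⬝ᵥ u = star u ⬝ᵥ v) :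
    (reflectionUnitary (u - v)).1.mulVec u = v := by
  change (householder (u - v)).mulVec u = v
  rw [householder_mulVec]
  have h1 : star (u - v) ⬝ᵥ (u - v) = 2 * (1 - star u ⬝ᵥ v) := by
    rw [star_sub, sub_dotProduct, dotProduct_sub, dotProduct_sub, hu, hv, huv]
    ring
  have h2 : star (u - v) ⬝ᵥ u = 1 - star u ⬝ᵥ v := by
    rw [star_sub, sub_dotProduct, hu, huv]
  by_cases h0 : 1 - star u ⬝ᵥ v = 0
  · have : u - v = 0 := by
      open scoped ComplexOrder in
      rw [← dotProduct_star_self_eq_zero, h1, h0, mul_zero]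
    rw [this, smul_zero, sub_zero]
    exact sub_eq_zero.1 this
  · rw [h1, h2]
    have : 2 / (2 * (1 - star u ⬝ᵥ v)) * (1 - star u ⬝ᵥ v) = 1 := by
      field_simp
    rw [this, one_smul, sub_sub_cancel]

/-- The matrix mapping the basis state `b` to `c b` times the basis state `e b`. -/
noncomputable def phasedPerm (e : Equiv.Perm ι) (c : ι → ℂ) : Matrix ι ι ℂ :=
  fun b b' => if b = e b' then c b' else 0

theorem phasedPerm_mulVec_single (e : Equiv.Perm ι) (c : ι → ℂ) (b : ι) (a : ℂ) :
    (phasedPerm e c).mulVec (Pi.single b a) = Pi.single (e b) (c b * a) := by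
  ext x
  rw [Matrix.mulVec_single]
  by_cases h : x = e b
  · subst h
    simp [phasedPerm, Matrix.col, Matrix.transpose]
  · simp [phasedPerm, Matrix.col, Matrix.transpose, h]

theorem phasedPerm_mem_unitaryGroup (e : Equiv.Perm ι) (c : ι → ℂ)
    (hc : ∀ b, star (c b) * c b = 1) : phasedPerm e c ∈ Matrix.unitaryGroup ι ℂ := by
  rw [Matrix.mem_unitaryGroup_iff']
  ext x y
  rw [Matrix.mul_apply, Finset.sum_eq_single (e x)]
  · by_cases h : x = y
    · subst h
      simpa [phasedPerm, Matrix.star_apply] using hc x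
    · simp [phasedPerm, h]
  · intro b _ hb
    simp [phasedPerm, Matrix.star_apply, hb]
  · simp

end Reflection

section Grover

variable {n : ℕ} {d : Fin n → ℕ} {i : Fin n}

/-- The vector with amplitude `f j` on `|i, j⟩ |ζ j⟩ |0⟩`. -/
def arrayVec (ζ : Fin (d i) → Fin n) (f : Fin (d i) → ℂ) : QBasis d 1 → ℂ :=
  ∑ j, Pi.single (⟨i, j⟩, ζ j, 0) (f j)

theorem arrayVec_apply (ζ : Fin (d i) → Fin n) (f : Fin (d i) → ℂ) (j : Fin (d i)) :
    arrayVec ζ f (⟨i, j⟩, ζ j, 0) = f j := by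
  rw [arrayVec, Finset.sum_apply, Finset.sum_eq_single j]
  · simp
  · intro k _ hk
    refine Pi.single_eq_of_ne ?_ _
    simp [Ne.symm hk]
  · simp

theorem arrayVec_sub_smul (ζ : Fin (d i) → Fin n) (f g : Fin (d i) → ℂ) (c : ℂ) :
    arrayVec ζ f - c • arrayVec ζ g = arrayVec ζ fun j => f j - c * g j := by
  simp only [arrayVec, Finset.smul_sum, ← Finset.sum_sub_distrib]
  refine Finset.sum_congr rfl fun j _ => ?_
  rw [Pi.single_sub, ← smul_eq_mul, Pi.single_smul]

theorem star_arrayVec_dotProduct (ζ : Fin (d i) → Fin n) (f g : Fin (d i) → ℂ) :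
    star (arrayVec ζ f) ⬝ᵥ arrayVec ζ g = ∑ j, star (f j) * g j := by
  conv_lhs => rw [arrayVec.eq_1 ζ g, dotProduct_sum]
  refine Finset.sum_congr rfl fun j _ => ?_
  rw [dotProduct_single, Pi.star_apply, arrayVec_apply]

theorem phasedPerm_mulVec_arrayVec (e : Equiv.Perm (Fin n)) (c : Fin n → ℂ)
    (ζ : Fin (d i) → Fin n) (f : Fin (d i) → ℂ) :
    (phasedPerm ((Equiv.refl _).prodCongr (e.prodCongr (Equiv.refl _))) fun b => c b.2.1).mulVec
      (arrayVec ζ f) = arrayVec (fun j => e (ζ j)) fun j => c (ζ j) * f j := by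
  rw [arrayVec, Matrix.mulVec_sum]
  simp only [phasedPerm_mulVec_single]
  rfl

theorem arrayVec_comp_oracle (G : AdjDAG n d) (ζ : Fin (d i) → Fin n) (f : Fin (d i) → ℂ) :
    (fun b => arrayVec ζ f ((G.oracle 1).symm b)) = arrayVec (fun j => ζ j + G.nbr i j) f := by
  ext b
  simp only [arrayVec, Finset.sum_apply]
  refine Finset.sum_congr rfl fun j _ => ?_
  simp only [Pi.single_apply, Equiv.symm_apply_eq]
  rfl

variable [NeZero n]

/-- The uniform superposition of the positions in `S`. -/
noncomputable def uniformVec (S : Finset (Fin (d i))) : QBasis d 1 → ℂ :=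
  arrayVec (fun _ => 0) fun j => if j ∈ S then (((√(S.card : ℝ))⁻¹ : ℝ) : ℂ) else 0

theorem star_uniformVec_dotProduct (S : Finset (Fin (d i))) (f : Fin (d i) → ℂ) :
    star (uniformVec S) ⬝ᵥ arrayVec (fun _ => 0) f =
      (((√(S.card : ℝ))⁻¹ : ℝ) : ℂ) * ∑ j ∈ S, f j := by
  rw [uniformVec, star_arrayVec_dotProduct, Finset.mul_sum]
  simp [apply_ite (starRingEnd ℂ), ite_mul, Finset.sum_ite_mem]

/-- The unitaries of Grover search for a position in `S` whose entry satisfies `P`: preparation of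
the uniform superposition, and alternately the phase oracle with a negation of the answer register,
so that the next query resets it, and the reflection about the uniform superposition. -/
noncomputable def groverUnitary (S : Finset (Fin (d i))) (j₀ : Fin (d i)) (P : Fin n → Prop)
    [DecidablePred P] (t : ℕ) : Matrix.unitaryGroup (QBasis d 1) ℂ :=
  if t = 0 then reflectionUnitary (Pi.single (⟨i, j₀⟩, 0, 0) 1 - uniformVec S)
  else if Even t then reflectionUnitary (uniformVec S)
  else ⟨phasedPerm ((Equiv.refl _).prodCongr ((Equiv.neg (Fin n)).prodCongr (Equiv.refl _)))
      fun b => if P b.2.1 then 1 else -1,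
    phasedPerm_mem_unitaryGroup _ _ fun b => by split_ifs <;> simp⟩

/-- Grover search with `r` iterations. -/
noncomputable def groverSubroutine (S : Finset (Fin (d i))) (j₀ : Fin (d i)) (P : Fin n → Prop)
    [DecidablePred P] (r : ℕ) : QuerySubroutine d where
  work := 1
  queries := 2 * r
  start := (⟨i, j₀⟩, 0, 0)
  unitary := groverUnitary S j₀ P

theorem exists_amplitudes (G : AdjDAG n d) (S : Finset (Fin (d i))) (hS : S.Nonempty)
    (j₀ : Fin (d i)) (P : Fin n → Prop) [DecidablePred P] (R : ℕ) {θ : ℝ}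
    (hsin : (S.card : ℝ) * Real.sin θ ^ 2 = (S.filter fun j => P (G.nbr i j)).card)
    (r : ℕ) : ∃ a b : ℝ,
      a * √(S.card : ℝ) * Real.sin θ = Real.sin ((2 * r + 1) * θ) ∧
      b * √(S.card : ℝ) * Real.cos θ = Real.cos ((2 * r + 1) * θ) ∧
      (groverSubroutine S j₀ P R).state G (2 * r) = arrayVec (fun _ => 0) fun j =>
        if j ∈ S then if P (G.nbr i j) then (a : ℂ) else b else 0 := by
  have hN : (0 : ℝ) < S.card := by exact_mod_cast hS.card_pos
  have hs : (0 : ℝ) < √(S.card : ℝ) := Real.sqrt_pos.2 hN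
  have hss : √(S.card : ℝ) * √(S.card : ℝ) = S.card := Real.mul_self_sqrt hN.le
  have hunit : star (uniformVec S) ⬝ᵥ uniformVec S = 1 := by
    have : star (uniformVec S) ⬝ᵥ uniformVec S = (((√(S.card : ℝ))⁻¹ : ℝ) : ℂ) *
        ∑ j ∈ S, if j ∈ S then (((√(S.card : ℝ))⁻¹ : ℝ) : ℂ) else 0 :=
      star_uniformVec_dotProduct S _
    rw [this, Finset.sum_congr rfl fun j hj => if_pos hj, Finset.sum_const, nsmul_eq_mul]
    have h : (√(S.card : ℝ))⁻¹ * (S.card * (√(S.card : ℝ))⁻¹) = 1 := by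
      rw [← hss]
      field_simp
      rw [Real.sqrt_sq hs.le]
    exact_mod_cast h
  induction r with
  | zero =>
    refine ⟨(√(S.card : ℝ))⁻¹, (√(S.card : ℝ))⁻¹, ?_, ?_, ?_⟩
    · rw [inv_mul_cancel₀ hs.ne']; simp
    · rw [inv_mul_cancel₀ hs.ne']; simp
    · simp only [ite_self]
      change (groverUnitary S j₀ P 0).1.mulVec (Pi.single (⟨i, j₀⟩, 0, 0) 1) = uniformVec S
      rw [groverUnitary, if_pos rfl]
      refine reflectionUnitary_sub_mulVec ?_ hunit ?_
      · simp [dotProduct_single]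
      · rw [dotProduct_single, mul_one, Pi.star_apply, ← Pi.single_star, star_one,
          single_dotProduct, one_mul, uniformVec, arrayVec_apply]
        split_ifs <;> simp
  | succ r ih =>
    obtain ⟨a, b, ha, hb, hst⟩ := ih
    set T : ℝ := Real.sin θ ^ 2 * a - Real.cos θ ^ 2 * b with hT
    refine ⟨a - 2 * T, - b - 2 * T, ?_, ?_, ?_⟩
    · have : (2 * ((r + 1 : ℕ) : ℝ) + 1) * θ = (2 * r + 1) * θ + 2 * θ := by push_cast; ring
      rw [this, Real.sin_add, ← ha, ← hb, hT, Real.sin_two_mul, Real.cos_two_mul]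
      linear_combination (2 * a * √(S.card : ℝ) * Real.sin θ) * (-Real.sin_sq_add_cos_sq θ)
    · have : (2 * ((r + 1 : ℕ) : ℝ) + 1) * θ = (2 * r + 1) * θ + 2 * θ := by push_cast; ring
      rw [this, Real.cos_add, ← ha, ← hb, hT, Real.sin_two_mul, Real.cos_two_mul]
      ring
    · have hodd : (groverUnitary S j₀ P (2 * r + 1)).1 = phasedPerm ((Equiv.refl _).prodCongr
          ((Equiv.neg (Fin n)).prodCongr (Equiv.refl _))) fun b => if P b.2.1 then 1 else -1 := by
        rw [groverUnitary, if_neg (by omega), if_neg (by simp)]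
      have heven : (groverUnitary S j₀ P (2 * r + 2)).1 = householder (uniformVec S) := by
        rw [groverUnitary, if_neg (by omega), if_pos (by simp [Nat.even_add])]
        rfl
      change (groverUnitary S j₀ P (2 * r + 2)).1.mulVec (fun b =>
        ((groverUnitary S j₀ P (2 * r + 1)).1.mulVec fun b =>
          (groverSubroutine S j₀ P R).state G (2 * r) ((G.oracle 1).symm b))
            ((G.oracle 1).symm b)) = _
      rw [hst, arrayVec_comp_oracle, hodd]
      have := phasedPerm_mulVec_arrayVec (Equiv.neg (Fin n)) (fun v => if P v then (1 : ℂ) else -1)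
        (fun j => 0 + G.nbr i j) fun j => if j ∈ S then if P (G.nbr i j) then (a : ℂ) else b else 0
      rw [this, arrayVec_comp_oracle]
      simp only [zero_add, Equiv.neg_apply, neg_add_cancel]
      rw [heven, householder_mulVec, hunit, star_uniformVec_dotProduct]
      have hsum : ∑ j ∈ S, (if P (G.nbr i j) then (1 : ℂ) else -1) *
          (if j ∈ S then if P (G.nbr i j) then (a : ℂ) else b else 0) = ((S.card * T : ℝ) : ℂ) := by
        have hu : (S.card : ℝ) * Real.cos θ ^ 2 =
            (S.filter fun j => ¬ P (G.nbr i j)).card := by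
          rw [Real.cos_sq', mul_sub, hsin, mul_one, sub_eq_iff_eq_add, add_comm]
          exact_mod_cast (Finset.card_filter_add_card_filter_not _).symm
        rw [← Finset.sum_filter_add_sum_filter_not S fun j => P (G.nbr i j),
          Finset.sum_congr rfl (g := fun _ => (a : ℂ)) fun j hj => by
            simp [(Finset.mem_filter.1 hj).1, (Finset.mem_filter.1 hj).2],
          Finset.sum_congr (s₁ := S.filter fun j => ¬ P (G.nbr i j)) rfl
            (g := fun _ => -(b : ℂ)) fun j hj => by
              simp [(Finset.mem_filter.1 hj).1, (Finset.mem_filter.1 hj).2],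
          Finset.sum_const, Finset.sum_const, nsmul_eq_mul, nsmul_eq_mul, hT, mul_sub,
          ← mul_assoc, ← mul_assoc, hsin, hu]
        push_cast
        ring
      rw [hsum, uniformVec, arrayVec_sub_smul]
      congr 1
      funext j
      have hTT : (2 : ℂ) / 1 * ((((√(S.card : ℝ))⁻¹ : ℝ) : ℂ) * ((S.card * T : ℝ) : ℂ)) *
          (((√(S.card : ℝ))⁻¹ : ℝ) : ℂ) = ((2 * T : ℝ) : ℂ) := by
        have h : 2 * ((√(S.card : ℝ))⁻¹ * (S.card * T)) * (√(S.card : ℝ))⁻¹ = 2 * T := by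
          field_simp
          rw [Real.sq_sqrt hN.le]
        rw [div_one]
        exact_mod_cast h
      by_cases hj : j ∈ S <;> by_cases hP : P (G.nbr i j) <;> simp only [hj, hP, if_true, if_false,
        hTT] <;> push_cast <;> ring

theorem groverSubroutine_prob_marked_ge (G : AdjDAG n d) (S : Finset (Fin (d i)))
    (hS : S.Nonempty) (j₀ : Fin (d i)) (P : Fin n → Prop) [DecidablePred P] (r : ℕ) {θ : ℝ}
    (hsin : (S.card : ℝ) * Real.sin θ ^ 2 = (S.filter fun j => P (G.nbr i j)).card)
    (hθ : 1 / 2 ≤ Real.sin ((2 * r + 1) * θ)) :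
    1 / 4 ≤ ∑ j ∈ S.filter fun j => P (G.nbr i j),
      (groverSubroutine S j₀ P r).outcome G (⟨i, j⟩, 0, (0 : Fin 1)) := by
  obtain ⟨a, b, ha, -, hst⟩ := exists_amplitudes G S hS j₀ P r hsin r
  have hprob : ∀ j ∈ S.filter fun j => P (G.nbr i j),
      (groverSubroutine S j₀ P r).outcome G (⟨i, j⟩, 0, (0 : Fin 1)) = ENNReal.ofReal (a ^ 2) := by
    intro j hj
    rw [Finset.mem_filter] at hj
    have hval : (groverSubroutine S j₀ P r).state G (2 * r) (⟨i, j⟩, 0, (0 : Fin 1)) = (a : ℂ) :=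
      (congrFun hst _).trans ((arrayVec_apply (fun _ => 0) _ j).trans (by simp [hj.1, hj.2]))
    exact (congrArg (fun x : ℂ => ENNReal.ofReal (‖x‖ ^ 2)) hval).trans
      (by rw [Complex.norm_real, Real.norm_eq_abs, sq_abs])
  rw [Finset.sum_congr rfl hprob, Finset.sum_const, nsmul_eq_mul, ← ENNReal.ofReal_natCast,
    ← ENNReal.ofReal_mul (by positivity), ← hsin]
  have hN : (0 : ℝ) ≤ S.card := by positivity
  have : (S.card : ℝ) * Real.sin θ ^ 2 * a ^ 2 = Real.sin ((2 * r + 1) * θ) ^ 2 := by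
    rw [← ha, mul_pow, mul_pow, Real.sq_sqrt hN]
    ring
  rw [this]
  calc (1 / 4 : ℝ≥0∞) = ENNReal.ofReal (1 / 4) := by
        rw [ENNReal.ofReal_div_of_pos (by norm_num)]; simp
    _ ≤ _ := ENNReal.ofReal_le_ofReal (by nlinarith)

theorem exists_pow_three_angle {t N : ℕ} (ht : 0 < t) (htN : t ≤ N) : ∃ θ : ℝ, ∃ l : ℕ,
    (N : ℝ) * Real.sin θ ^ 2 = t ∧ l ≤ Nat.log 9 (4 * N) ∧ 1 / 2 ≤ Real.sin (3 ^ l * θ) := by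
  have hN : (0 : ℝ) < N := by exact_mod_cast ht.trans_le htN
  have ht' : (0 : ℝ) < t := by exact_mod_cast ht
  have ht1 : (1 : ℝ) ≤ t := by exact_mod_cast ht
  have hle : √((t : ℝ) / N) ≤ 1 := Real.sqrt_le_one.2 ((div_le_one hN).2 (by exact_mod_cast htN))
  have hpos : 0 < √((t : ℝ) / N) := Real.sqrt_pos.2 (by positivity)
  set θ := Real.arcsin √((t : ℝ) / N) with hθ
  have hsin : Real.sin θ = √((t : ℝ) / N) := Real.sin_arcsin (by linarith) hle
  have hθpos : 0 < θ := Real.arcsin_pos.2 hpos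
  have hθle : θ ≤ Real.pi / 2 := Real.arcsin_le_pi_div_two _
  have hsinsq : (N : ℝ) * Real.sin θ ^ 2 = t := by
    rw [hsin, Real.sq_sqrt (by positivity)]
    field_simp
  obtain ⟨l, hl, hl'⟩ := exists_nat_pow_near (x := Real.pi / 2 / θ) (y := 3)
    ((one_le_div hθpos).2 hθle) (by norm_num)
  rw [le_div_iff₀ hθpos] at hl
  rw [div_lt_iff₀ hθpos, pow_succ] at hl'
  refine ⟨θ, l, hsinsq, ?_, ?_⟩
  · refine Nat.le_log_of_pow_le (by norm_num) ?_
    have hθsin : Real.sin θ ≤ θ := Real.sin_le hθpos.le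
    have hsθ : 0 < Real.sin θ := by rw [hsin]; exact hpos
    have hpi := Real.pi_le_four
    have h3 : (3 : ℝ) ^ l * Real.sin θ ≤ 2 :=
      (mul_le_mul_of_nonneg_left hθsin (by positivity)).trans (by linarith)
    have h9 : ((3 : ℝ) ^ l * Real.sin θ) ^ 2 ≤ 2 ^ 2 := by gcongr
    have : ((9 ^ l : ℕ) : ℝ) ≤ ((4 * N : ℕ) : ℝ) := by
      push_cast
      have e : (9 : ℝ) ^ l = (3 ^ l) ^ 2 := by rw [← pow_mul, mul_comm, pow_mul]; norm_num
      rw [e]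
      calc ((3 : ℝ) ^ l) ^ 2 ≤ (3 ^ l) ^ 2 * t := le_mul_of_one_le_right (by positivity) ht1
        _ = N * ((3 : ℝ) ^ l * Real.sin θ) ^ 2 := by rw [← hsinsq]; ring
        _ ≤ N * 2 ^ 2 := by gcongr
        _ = 4 * N := by ring
    exact_mod_cast this
  · rw [← Real.sin_pi_div_six]
    have := Real.pi_pos
    exact Real.sin_le_sin_of_le_of_le_pi_div_two (by linarith) hl (by linarith)

end Grover

/-! ### Repeated searches -/

section Search

variable {n : ℕ} {d : Fin n → ℕ} {α : Type}

/-- Run `p`, and if it finds nothing, run `q`. -/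
def Prog.orElse (p q : Prog d (Option α)) : Prog d (Option α) :=
  p.bind fun o => match o with
    | some z => .ret (some z)
    | none => q

/-- Every value found by `p` satisfies `Q`. -/
def Prog.FindsOnly (G : AdjDAG n d) (p : Prog d (Option α)) (Q : α → Prop) : Prop :=
  ∀ x ∈ (p.exec G).support, ∀ z, x.1 = some z → Q z

variable (G : AdjDAG n d)

theorem Prog.findsOnly_ret_none (Q : α → Prop) :
    (Prog.ret none : Prog d (Option α)).FindsOnly G Q := by
  intro x hx z hz
  rw [Prog.mem_support_ret] at hx
  simp [hx] at hz

theorem Prog.mem_support_orElse {p q : Prog d (Option α)} {x : Option α × ℕ}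
    (hx : x ∈ ((p.orElse q).exec G).support) :
    (∃ z, x.1 = some z ∧ x ∈ (p.exec G).support) ∨
      ∃ t, (none, t) ∈ (p.exec G).support ∧ ∃ y ∈ (q.exec G).support, x = (y.1, t + y.2) := by
  rw [Prog.orElse, Prog.mem_support_bind] at hx
  obtain ⟨⟨o, t⟩, hy, z, hz, rfl⟩ := hx
  cases o with
  | none => exact .inr ⟨t, hy, z, hz, rfl⟩
  | some w =>
    rw [Prog.mem_support_ret] at hz
    subst hz
    exact .inl ⟨w, rfl, hy⟩

theorem Prog.FindsOnly.orElse {p q : Prog d (Option α)} {Q : α → Prop}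
    (hp : p.FindsOnly G Q) (hq : q.FindsOnly G Q) : (p.orElse q).FindsOnly G Q := by
  intro x hx z hz
  rcases Prog.mem_support_orElse G hx with ⟨-, -, hx⟩ | ⟨t, -, y, hy, rfl⟩
  · exact hp x hx z hz
  · exact hq y hy z hz

theorem Prog.errorProb_orElse_isSome_le (p q : Prog d (Option α)) :
    (p.orElse q).errorProb G (fun o => o.isSome) ≤
      p.errorProb G (fun o => o.isSome) * q.errorProb G (fun o => o.isSome) := by
  have key : ∀ o : Option α, o.isSome → (match o with
      | some z => Prog.ret (some z)
      | none => q).errorProb G (fun o => o.isSome) = 0 := by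
    intro o ho
    cases o with
    | none => simp at ho
    | some z => exact Prog.errorProb_ret G rfl
  refine (Prog.errorProb_bind_le G p _ (fun o => o.isSome) _ (δ := 0) (fun o ho => (key o ho).le)
    fun o => ?_).trans (zero_add _).le
  cases o with
  | none => exact le_rfl
  | some z => exact (key (some z) rfl).le.trans zero_le

/-- Run `f 0, …, f (k - 1)` until one of them finds something. -/
def tryAll (f : ℕ → Prog d (Option α)) : ℕ → Prog d (Option α)
  | 0 => .ret none
  | k + 1 => (tryAll f k).orElse (f k)

theorem tryAll_findsOnly {f : ℕ → Prog d (Option α)} {Q : α → Prop}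
    (hf : ∀ l, (f l).FindsOnly G Q) (k : ℕ) : (tryAll f k).FindsOnly G Q := by
  induction k with
  | zero => exact Prog.findsOnly_ret_none G Q
  | succ k ih => exact ih.orElse G (hf k)

theorem tryAll_time {f : ℕ → Prog d (Option α)} {T : ℕ → ℝ}
    (hf : ∀ l, ∀ x ∈ ((f l).exec G).support, (x.2 : ℝ) ≤ T l) (hT : ∀ l, 0 ≤ T l) (k : ℕ) :
    ∀ x ∈ ((tryAll f k).exec G).support, (x.2 : ℝ) ≤ ∑ l ∈ Finset.range k, T l := by
  induction k with
  | zero =>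
    intro x hx
    rw [tryAll, Prog.mem_support_ret] at hx
    simp [hx]
  | succ k ih =>
    intro x hx
    rw [Finset.sum_range_succ]
    rcases Prog.mem_support_orElse G hx with ⟨-, -, hx⟩ | ⟨t, ht, y, hy, rfl⟩
    · linarith [ih x hx, hT k]
    · have := ih _ ht
      have := hf k y hy
      push_cast
      linarith

theorem tryAll_errorProb_le {f : ℕ → Prog d (Option α)} {e : ℕ → ℝ≥0∞}
    (hf : ∀ l, (f l).errorProb G (fun o => o.isSome) ≤ e l) (k : ℕ) :
    (tryAll f k).errorProb G (fun o => o.isSome) ≤ ∏ l ∈ Finset.range k, e l := by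
  induction k with
  | zero => simpa using Prog.errorProb_le_one G _ _
  | succ k ih =>
    rw [Finset.prod_range_succ]
    exact (Prog.errorProb_orElse_isSome_le G _ _).trans (mul_le_mul' ih (hf k))

variable {i : Fin n} [NeZero n] (P : Fin n → Prop) [DecidablePred P]

open Classical in
/-- Run Grover search once and verify the measured position with a classical query. -/
noncomputable def groverRun (S : Finset (Fin (d i))) (j₀ : Fin (d i)) (r : ℕ) :
    Prog d (Option (Fin (d i))) :=
  .quantum (groverSubroutine S j₀ P r) fun b =>
    if h : ∃ j ∈ S, b.1 = ⟨i, j⟩ then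
      .read i h.choose fun v => .ret (if P v then some h.choose else none)
    else .ret none

theorem groverRun_findsOnly (S : Finset (Fin (d i))) (j₀ : Fin (d i)) (r : ℕ) :
    (groverRun P S j₀ r).FindsOnly G fun z => z ∈ S ∧ P (G.nbr i z) := by
  intro x hx z hz
  obtain ⟨b, y, hy, rfl⟩ := Prog.mem_support_quantum G hx
  split_ifs at hy with h
  · rw [Prog.mem_support_read] at hy
    obtain ⟨y', hy', rfl⟩ := hy
    rw [Prog.mem_support_ret] at hy'
    subst hy'
    split_ifs at hz with hP
    · simp only [Option.some.injEq] at hz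
      subst hz
      exact ⟨h.choose_spec.1, hP⟩
  · rw [Prog.mem_support_ret] at hy
    subst hy
    simp at hz

theorem groverRun_time (S : Finset (Fin (d i))) (j₀ : Fin (d i)) (r : ℕ) :
    ∀ x ∈ ((groverRun P S j₀ r).exec G).support, x.2 ≤ 2 * r + 1 := by
  intro x hx
  obtain ⟨b, y, hy, rfl⟩ := Prog.mem_support_quantum G hx
  change y.2 + 2 * r ≤ 2 * r + 1
  split_ifs at hy with h
  · rw [Prog.mem_support_read] at hy
    obtain ⟨y', hy', rfl⟩ := hy
    rw [Prog.mem_support_ret] at hy'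
    subst hy'
    simp only
    omega
  · rw [Prog.mem_support_ret] at hy
    subst hy
    simp only
    omega

theorem groverRun_errorProb_le (S : Finset (Fin (d i))) (hS : S.Nonempty) (j₀ : Fin (d i))
    (r : ℕ) {θ : ℝ}
    (hsin : (S.card : ℝ) * Real.sin θ ^ 2 = (S.filter fun j => P (G.nbr i j)).card)
    (hθ : 1 / 2 ≤ Real.sin ((2 * r + 1) * θ)) :
    (groverRun P S j₀ r).errorProb G (fun o => o.isSome) ≤ 3 / 4 := by
  classical
  have hge := groverSubroutine_prob_marked_ge G S hS j₀ P r hsin hθ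
  set Q := groverSubroutine S j₀ P r with hQ
  let emb : Fin (d i) ↪ QBasis d Q.work :=
    ⟨fun j => (⟨i, j⟩, 0, (0 : Fin 1)), fun j j' h => by simpa using h⟩
  let M : Finset (QBasis d Q.work) := (S.filter fun j => P (G.nbr i j)).map emb
  have hM : 1 / 4 ≤ ∑ b ∈ M, Q.outcome G b := by
    rw [Finset.sum_map]
    exact hge
  rw [groverRun, Prog.errorProb_quantum, tsum_fintype]
  have htotal : ∑ b ∈ M, Q.outcome G b + ∑ b ∈ Mᶜ, Q.outcome G b = 1 := by
    rw [Finset.sum_add_sum_compl, ← tsum_fintype (L := .unconditional _), PMF.tsum_coe]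
  have hcompl : ∑ b ∈ Mᶜ, Q.outcome G b ≤ 3 / 4 := by
    have h4 : (1 / 4 : ℝ≥0∞) + 3 / 4 = 1 := by
      rw [← ENNReal.add_div]
      norm_num
      exact ENNReal.div_self (by norm_num) (by norm_num)
    have : (1 / 4 : ℝ≥0∞) + ∑ b ∈ Mᶜ, Q.outcome G b ≤ 1 / 4 + 3 / 4 :=
      (add_le_add_left hM _).trans (htotal.trans h4.symm).le
    exact (ENNReal.add_le_add_iff_left (by simp)).1 this
  refine le_trans ?_ hcompl
  rw [← Finset.sum_add_sum_compl M, ← zero_add (∑ b ∈ Mᶜ, Q.outcome G b)]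
  refine add_le_add (le_of_eq (Finset.sum_eq_zero fun b hb => ?_))
    (Finset.sum_le_sum fun b _ => mul_le_of_le_one_right' (Prog.errorProb_le_one G _ _))
  obtain ⟨j, hj, rfl⟩ := Finset.mem_map.1 hb
  rw [Finset.mem_filter] at hj
  have h : ∃ k ∈ S, (emb j).1 = ⟨i, k⟩ := ⟨j, hj.1, rfl⟩
  have hk : h.choose = j :=
    (eq_of_heq (Sigma.mk.inj h.choose_spec.2).2).symm
  rw [dif_pos h, Prog.errorProb_read, hk, if_pos hj.2,
    Prog.errorProb_ret G (a := some j) (good := fun o => o.isSome) rfl, mul_zero]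

/-- Grover search in `S` for an unknown number of solutions: the numbers `r` of iterations are those
with `2 r + 1 = 3 ^ l`, as long as `3 ^ l ≤ 2 √|S|`. -/
noncomputable def attempt (S : Finset (Fin (d i))) (j₀ : Fin (d i)) :
    Prog d (Option (Fin (d i))) :=
  tryAll (fun l => groverRun P S j₀ ((3 ^ l - 1) / 2)) (Nat.log 9 (4 * S.card) + 1)

theorem two_mul_pow_three_sub_one_half (l : ℕ) : 2 * ((3 ^ l - 1) / 2) + 1 = 3 ^ l := by
  have h : Odd (3 ^ l) := Odd.pow (by decide)
  obtain ⟨k, hk⟩ := h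
  omega

theorem attempt_findsOnly (S : Finset (Fin (d i))) (j₀ : Fin (d i)) :
    (attempt P S j₀).FindsOnly G fun z => z ∈ S ∧ P (G.nbr i z) :=
  tryAll_findsOnly G (fun _ => groverRun_findsOnly G P S j₀ _) _

theorem attempt_time (S : Finset (Fin (d i))) (hS : S.Nonempty) (j₀ : Fin (d i)) :
    ∀ x ∈ ((attempt P S j₀).exec G).support, (x.2 : ℝ) ≤ 3 * √(S.card : ℝ) := by
  intro x hx
  have h := tryAll_time G (T := fun l => (3 : ℝ) ^ l) (fun l x hx => by
    have := groverRun_time G P S j₀ _ x hx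
    rw [two_mul_pow_three_sub_one_half] at this
    exact_mod_cast this) (fun l => by positivity) _ x hx
  refine h.trans ?_
  rw [geom_sum_eq (by norm_num), pow_succ]
  have h9 : 9 ^ Nat.log 9 (4 * S.card) ≤ 4 * S.card :=
    Nat.pow_log_le_self 9 (by have := hS.card_pos; omega)
  have : (3 : ℝ) ^ Nat.log 9 (4 * S.card) ≤ 2 * √(S.card : ℝ) := by
    refine (sq_le_sq₀ (by positivity) (by positivity)).1 ?_
    rw [mul_pow, Real.sq_sqrt (by positivity), ← pow_mul, mul_comm _ 2, pow_mul]
    norm_num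
    exact_mod_cast h9
  linarith

theorem attempt_errorProb_le (S : Finset (Fin (d i))) (j₀ : Fin (d i))
    (h : ∃ j ∈ S, P (G.nbr i j)) :
    (attempt P S j₀).errorProb G (fun o => o.isSome) ≤ 3 / 4 := by
  obtain ⟨j, hj, hPj⟩ := h
  obtain ⟨θ, l₀, hsin, hl₀, hθ⟩ := exists_pow_three_angle (N := S.card)
    (t := (S.filter fun j => P (G.nbr i j)).card)
    (Finset.card_pos.2 ⟨j, Finset.mem_filter.2 ⟨hj, hPj⟩⟩) (Finset.card_filter_le _ _)
  refine (tryAll_errorProb_le G (e := fun l => if l = l₀ then 3 / 4 else 1) (fun l => ?_) _).trans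
    (le_of_eq ?_)
  · split_ifs with hl
    · subst hl
      refine groverRun_errorProb_le G P S ⟨j, hj⟩ j₀ _ hsin ?_
      have : (2 * (((3 ^ l - 1) / 2 : ℕ) : ℝ) + 1) = 3 ^ l := by
        exact_mod_cast two_mul_pow_three_sub_one_half l
      rw [this]
      exact hθ
    · exact Prog.errorProb_le_one G _ _
  · rw [Finset.prod_ite_eq' (Finset.range _) l₀ fun _ => (3 / 4 : ℝ≥0∞), if_pos]
    rw [Finset.mem_range]
    omega

/-- The positions of `D_i` from `a` on, before `b`. -/
def positions (i : Fin n) (d : Fin n → ℕ) (a b : ℕ) : Finset (Fin (d i)) :=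
  Finset.univ.filter fun j => a ≤ j.1 ∧ j.1 < b

omit [NeZero n] in
theorem mem_positions {a b : ℕ} {j : Fin (d i)} : j ∈ positions i d a b ↔ a ≤ j.1 ∧ j.1 < b := by
  simp [positions]

omit [NeZero n] in
theorem card_positions_le (a b : ℕ) : (positions i d a b).card ≤ b - a := by
  rw [← Nat.card_Ico, ← Finset.card_map Fin.valEmbedding]
  refine Finset.card_le_card fun x hx => ?_
  obtain ⟨j, hj, rfl⟩ := Finset.mem_map.1 hx
  exact Finset.mem_Ico.2 (mem_positions.1 hj)

/-- Search the positions of `D_i` in `[a, b)` with `t` attempts. -/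
noncomputable def search (i : Fin n) (t a b : ℕ) : Prog d (Option (Fin (d i))) :=
  if h : (positions i d a b).Nonempty then tryAll (fun _ => attempt P (positions i d a b) h.choose) t
  else .ret none

theorem search_findsOnly (t a b : ℕ) :
    (search P i t a b).FindsOnly G fun z => (a ≤ z.1 ∧ z.1 < b) ∧ P (G.nbr i z) := by
  rw [search]
  split_ifs with h
  · simp only [← mem_positions]
    exact tryAll_findsOnly G (fun _ => attempt_findsOnly G P _ _) _
  · exact Prog.findsOnly_ret_none G _

theorem search_time (t a N : ℕ) :
    ∀ x ∈ ((search P i t a (a + N)).exec G).support, (x.2 : ℝ) ≤ 3 * t * √(N : ℝ) := by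
  intro x hx
  rw [search] at hx
  split_ifs at hx with h
  · have hle : ∀ y ∈ ((attempt P (positions i d a (a + N)) h.choose).exec G).support,
        (y.2 : ℝ) ≤ 3 * √(N : ℝ) := by
      intro y hy
      refine (attempt_time G P _ h _ y hy).trans ?_
      have : ((positions i d a (a + N)).card : ℝ) ≤ N := by
        exact_mod_cast (card_positions_le a (a + N)).trans (by omega)
      gcongr
    have := tryAll_time G (fun _ => hle) (fun _ => by positivity) t x hx
    rw [Finset.sum_const, Finset.card_range, nsmul_eq_mul] at this
    linarith
  · rw [Prog.mem_support_ret] at hx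
    subst hx
    simp only [Nat.cast_zero]
    positivity

theorem search_errorProb_le (t a b : ℕ)
    (h : ∃ j : Fin (d i), (a ≤ j.1 ∧ j.1 < b) ∧ P (G.nbr i j)) :
    (search P i t a b).errorProb G (fun o => o.isSome) ≤ (3 / 4) ^ t := by
  simp only [← mem_positions] at h
  obtain ⟨j, hj, hPj⟩ := h
  rw [search, dif_pos ⟨j, hj⟩]
  refine (tryAll_errorProb_le G (fun _ => attempt_errorProb_le G P _ _ ⟨j, hj, hPj⟩) t).trans ?_
  simp

end Search

/-! ### The first-one search -/

section FirstOne

variable {n : ℕ} {d : Fin n → ℕ}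

/-- `o` is the first position of `D_i` in `[a, b)` whose entry satisfies `P`, or `none` if there is
no such position. -/
structure IsFirstIn (G : AdjDAG n d) (P : Fin n → Prop) (i : Fin n) (a b : ℕ)
    (o : Option (Fin (d i))) : Prop where
  of_some : ∀ z, o = some z → (a ≤ z.1 ∧ z.1 < b) ∧ P (G.nbr i z) ∧
    ∀ y : Fin (d i), a ≤ y.1 → y < z → ¬ P (G.nbr i y)
  of_none : o = none → ∀ y : Fin (d i), a ≤ y.1 → y.1 < b → ¬ P (G.nbr i y)

variable {G : AdjDAG n d} {P : Fin n → Prop} {i : Fin n}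

theorem IsFirstIn.unique {a b : ℕ} {o o' : Option (Fin (d i))} (h : IsFirstIn G P i a b o)
    (h' : IsFirstIn G P i a b o') : o = o' := by
  cases o with
  | none =>
    cases o' with
    | none => rfl
    | some z' =>
      obtain ⟨hz, hP, -⟩ := h'.of_some z' rfl
      exact absurd hP (h.of_none rfl z' hz.1 hz.2)
  | some z =>
    obtain ⟨hz, hP, hmin⟩ := h.of_some z rfl
    cases o' with
    | none => exact absurd hP (h'.of_none rfl z hz.1 hz.2)
    | some z' =>
      obtain ⟨hz', hP', hmin'⟩ := h'.of_some z' rfl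
      rcases lt_trichotomy z z' with hlt | rfl | hlt
      · exact absurd hP (hmin' z hz.1 hlt)
      · rfl
      · exact absurd hP' (hmin z' hz'.1 hlt)

theorem IsFirstIn.of_split_some {a m b : ℕ} {o : Option (Fin (d i))} (h : IsFirstIn G P i a m o)
    (ho : o.isSome) (hmb : m ≤ b) : IsFirstIn G P i a b o where
  of_some z hz := by
    obtain ⟨h1, h2⟩ := h.of_some z hz
    exact ⟨⟨h1.1, h1.2.trans_le hmb⟩, h2⟩
  of_none hn := by simp [hn] at ho

theorem IsFirstIn.of_split_none {a m b : ℕ} {o : Option (Fin (d i))}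
    (hnone : ∀ y : Fin (d i), a ≤ y.1 → y.1 < m → ¬ P (G.nbr i y)) (h : IsFirstIn G P i m b o)
    (ham : a ≤ m) : IsFirstIn G P i a b o where
  of_some z hz := by
    obtain ⟨h1, h2, h3⟩ := h.of_some z hz
    refine ⟨⟨ham.trans h1.1, h1.2⟩, h2, fun y hay hyz => ?_⟩
    by_cases hym : y.1 < m
    · exact hnone y hay hym
    · exact h3 y (not_lt.1 hym) hyz
  of_none hn y hay hyb := by
    by_cases hym : y.1 < m
    · exact hnone y hay hym
    · exact h.of_none hn y (not_lt.1 hym) hyb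

theorem firstOne_isFirstIn (G : AdjDAG n d) (visited : Finset (Fin n)) (i : Fin n)
    (start : ℕ) : IsFirstIn G (fun v => v ∉ visited ∧ 0 < d v) i start (d i)
      (G.firstOne visited i start) where
  of_some z hz := by
    obtain ⟨hz1, as, bs, hl, has⟩ := List.find?_eq_some_iff_append.1 hz
    simp only [decide_eq_true_eq] at hz1
    refine ⟨⟨hz1.1, z.2⟩, hz1.2, fun y hy hyz hP => ?_⟩
    have hmem : y ∈ as ++ z :: bs := hl ▸ List.mem_finRange y
    have hsort : (as ++ z :: bs).Pairwise (· < ·) := hl ▸ List.pairwise_lt_finRange _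
    rcases List.mem_append.1 hmem with h | h
    · simpa [hy, hP.1, hP.2] using has y h
    · rcases List.mem_cons.1 h with rfl | h
      · exact lt_irrefl _ hyz
      · have := (List.pairwise_cons.1 (List.pairwise_append.1 hsort).2.1).1 y h
        exact lt_asymm this hyz
  of_none hn y hy _ hP := by
    have := List.find?_eq_none.1 hn y (List.mem_finRange y)
    simp [hy, hP.1, hP.2] at this

variable (G) (P) [DecidablePred P] [NeZero n]

/-- Binary search for the first position in `[a, a + 2 ^ k)`. The number of attempts grows with the
depth so that the error probabilities sum up to a constant multiple of the first one. -/
noncomputable def firstIn (i : Fin n) : ℕ → ℕ → ℕ → Prog d (Option (Fin (d i)))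
  | 0, _, a => if h : a < d i then
      .read i ⟨a, h⟩ fun v => .ret (if P v then some ⟨a, h⟩ else none)
    else .ret none
  | k + 1, t, a => (search P i t a (a + 2 ^ k)).bind fun o =>
      if o.isSome then firstIn i k (t + 3) a else firstIn i k (t + 3) (a + 2 ^ k)

theorem firstIn_findsOnly (k t a : ℕ) :
    (firstIn P i k t a).FindsOnly G fun z => (a ≤ z.1 ∧ z.1 < a + 2 ^ k) ∧ P (G.nbr i z) := by
  induction k generalizing t a with
  | zero =>
    intro x hx z hz
    rw [firstIn] at hx
    split_ifs at hx with h
    · rw [Prog.mem_support_read] at hx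
      obtain ⟨y, hy, rfl⟩ := hx
      rw [Prog.mem_support_ret] at hy
      subst hy
      split_ifs at hz with hP
      · simp only [Option.some.injEq] at hz
        subst hz
        exact ⟨by simp, hP⟩
    · rw [Prog.mem_support_ret] at hx
      simp [hx] at hz
  | succ k ih =>
    intro x hx z hz
    rw [firstIn, Prog.mem_support_bind] at hx
    obtain ⟨y, -, w, hw, rfl⟩ := hx
    rw [pow_succ]
    split_ifs at hw
    · obtain ⟨h1, h2⟩ := ih _ _ w hw z hz
      exact ⟨by omega, h2⟩
    · obtain ⟨h1, h2⟩ := ih _ _ w hw z hz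
      exact ⟨by omega, h2⟩

theorem sqrt_two_bounds : (1.414 : ℝ) ≤ √2 ∧ √2 * √2 = 2 :=
  ⟨Real.le_sqrt_of_sq_le (by norm_num), Real.mul_self_sqrt (by norm_num)⟩

theorem firstIn_time (k t a : ℕ) :
    ∀ x ∈ ((firstIn P i k t a).exec G).support, (x.2 : ℝ) ≤ (8 * t + 60) * √2 ^ k := by
  induction k generalizing t a with
  | zero =>
    intro x hx
    have hpos : (1 : ℝ) ≤ (8 * t + 60) * √2 ^ 0 := by
      have : (0 : ℝ) ≤ t := by positivity
      rw [pow_zero]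
      linarith
    rw [firstIn] at hx
    split_ifs at hx with h
    · rw [Prog.mem_support_read] at hx
      obtain ⟨y, hy, rfl⟩ := hx
      rw [Prog.mem_support_ret] at hy
      subst hy
      simpa using hpos
    · rw [Prog.mem_support_ret] at hx
      subst hx
      simp only [Nat.cast_zero]
      linarith
  | succ k ih =>
    intro x hx
    rw [firstIn, Prog.mem_support_bind] at hx
    obtain ⟨y, hy, w, hw, rfl⟩ := hx
    have h1 := search_time G P t a (2 ^ k) y hy
    have h2 : (w.2 : ℝ) ≤ (8 * ((t + 3 : ℕ) : ℝ) + 60) * √2 ^ k := by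
      split_ifs at hw
      · exact ih _ _ w hw
      · exact ih _ _ w hw
    have hsqrt : √((2 ^ k : ℕ) : ℝ) = √2 ^ k := by
      rw [Nat.cast_pow, Nat.cast_ofNat, Real.sqrt_eq_iff_mul_self_eq (by positivity) (by positivity),
        ← mul_pow, sqrt_two_bounds.2]
    rw [hsqrt] at h1
    push_cast at h2 ⊢
    rw [pow_succ]
    have hb := sqrt_two_bounds.1
    have ht : (0 : ℝ) ≤ t := by positivity
    have hk : (0 : ℝ) < √2 ^ k := by positivity
    have key : 3 * (t : ℝ) + (8 * (t + 3) + 60) ≤ (8 * t + 60) * √2 := by nlinarith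
    calc (y.2 : ℝ) + w.2 ≤ (3 * (t : ℝ) + (8 * (t + 3) + 60)) * √2 ^ k := by linarith
      _ ≤ (8 * t + 60) * √2 * √2 ^ k := by gcongr
      _ = _ := by ring

omit [DecidablePred P] [NeZero n] in
theorem errorProb_eq_none_of_forall_not {a b : ℕ} {p : Prog d (Option (Fin (d i)))}
    (hp : p.FindsOnly G fun z => (a ≤ z.1 ∧ z.1 < b) ∧ P (G.nbr i z))
    (hnone : ∀ y : Fin (d i), a ≤ y.1 → y.1 < b → ¬ P (G.nbr i y)) :
    p.errorProb G (fun o => o = none) = 0 := by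
  refine Prog.errorProb_eq_zero G p fun x hx => ?_
  cases h : x.1 with
  | none => rfl
  | some z =>
    obtain ⟨hz, hP⟩ := hp x hx z h
    exact absurd hP (hnone z hz.1 hz.2)

theorem firstIn_errorProb_le (k t a : ℕ) :
    (firstIn P i k t a).errorProb G (IsFirstIn G P i a (a + 2 ^ k)) ≤ 2 * (3 / 4) ^ t := by
  induction k generalizing t a with
  | zero =>
    refine le_of_eq_of_le (Prog.errorProb_eq_zero G _ fun x hx => ?_) zero_le
    have hfind := firstIn_findsOnly G P (i := i) 0 t a
    rw [firstIn] at hx hfind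
    split_ifs at hx with h
    · rw [Prog.mem_support_read] at hx
      obtain ⟨y, hy, rfl⟩ := hx
      rw [Prog.mem_support_ret] at hy
      subst hy
      constructor
      · intro z hz
        split_ifs at hz with hP
        simp only [Option.some.injEq] at hz
        subst hz
        refine ⟨by simp, hP, fun y hy hlt => ?_⟩
        rw [Fin.lt_def] at hlt
        exact absurd hy (not_le.2 hlt)
      · intro hz y hy hy'
        have hya : y = ⟨a, h⟩ := Fin.ext (by simp only; omega)
        split_ifs at hz with hP
        rwa [hya]
    · rw [Prog.mem_support_ret] at hx
      subst hx
      constructor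
      · simp
      · intro _ y hy
        have := y.2
        omega
  | succ k ih =>
    have hsum : ∀ s : ℕ, (3 / 4 : ℝ≥0∞) ^ s + 2 * (3 / 4) ^ (s + 3) ≤ 2 * (3 / 4) ^ s := by
      intro s
      have h : (2 : ℝ≥0∞) * (3 / 4) ^ 3 ≤ 1 := by
        rw [← ENNReal.toReal_le_toReal (by finiteness) (by finiteness)]
        simp
        norm_num
      calc (3 / 4 : ℝ≥0∞) ^ s + 2 * (3 / 4) ^ (s + 3)
          = (3 / 4) ^ s + (3 / 4) ^ s * (2 * (3 / 4) ^ 3) := by rw [pow_add]; ring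
        _ ≤ (3 / 4) ^ s + (3 / 4) ^ s * 1 := by gcongr
        _ = 2 * (3 / 4) ^ s := by ring
    have hpow : a + 2 ^ (k + 1) = a + 2 ^ k + 2 ^ k := by rw [pow_succ]; ring
    by_cases h : ∃ j : Fin (d i), (a ≤ j.1 ∧ j.1 < a + 2 ^ k) ∧ P (G.nbr i j)
    · refine (Prog.errorProb_bind_le_add G _ _ (fun o => o.isSome) _
        (δ := 2 * (3 / 4) ^ (t + 3)) fun o ho => ?_).trans ?_
      · rw [if_pos ho]
        refine (Prog.errorProb_mono G _ fun o ho => ?_).trans (ih _ _)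
        refine ho.of_split_some (Option.isSome_iff_ne_none.2 fun hn => ?_) (by omega)
        obtain ⟨j, hj, hP⟩ := h
        exact ho.of_none hn j hj.1 hj.2 hP
      · rw [add_comm]
        exact (add_le_add (search_errorProb_le G P t _ _ h) le_rfl).trans (hsum t)
    · have hn : ∀ y : Fin (d i), a ≤ y.1 → y.1 < a + 2 ^ k → ¬ P (G.nbr i y) :=
        fun y h1 h2 h3 => h ⟨y, ⟨h1, h2⟩, h3⟩
      refine (Prog.errorProb_bind_le_add G _ _ (fun o => o = none) _
        (δ := 2 * (3 / 4) ^ (t + 3)) fun o ho => ?_).trans ?_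
      · subst ho
        refine (Prog.errorProb_mono G _ fun o ho => ?_).trans (ih (t + 3) (a + 2 ^ k))
        rw [hpow]
        exact IsFirstIn.of_split_none hn ho (Nat.le_add_right _ _)
      · rw [errorProb_eq_none_of_forall_not G P (search_findsOnly G P t a _) hn, add_zero]
        exact le_add_self.trans (hsum t)

/-- Search the blocks `[start + 2 ^ k - 1, start + 2 ^ (k + 1) - 1)` for increasing `k`. The first
argument bounds the number of blocks. -/
noncomputable def blockSearch (i : Fin n) (t start : ℕ) : ℕ → ℕ → Prog d (Option (Fin (d i)))
  | 0, _ => .ret none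
  | fuel + 1, k => if start + 2 ^ k - 1 < d i then
      (firstIn P i k t (start + 2 ^ k - 1)).orElse (blockSearch i t start fuel (k + 1))
    else .ret none

theorem blockSearch_findsOnly (t start fuel k : ℕ) :
    (blockSearch P i t start fuel k).FindsOnly G fun z =>
      (start + 2 ^ k - 1 ≤ z.1 ∧ z.1 < d i) ∧ P (G.nbr i z) := by
  induction fuel generalizing k with
  | zero => exact Prog.findsOnly_ret_none G _
  | succ fuel ih =>
    rw [blockSearch]
    split_ifs with h
    · refine Prog.FindsOnly.orElse G ?_ ?_
      · intro x hx z hz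
        obtain ⟨h1, h2⟩ := firstIn_findsOnly G P k t _ x hx z hz
        exact ⟨⟨h1.1, z.2⟩, h2⟩
      · intro x hx z hz
        obtain ⟨h1, h2⟩ := ih (k + 1) x hx z hz
        rw [pow_succ] at h1
        exact ⟨⟨by omega, z.2⟩, h2⟩
    · exact Prog.findsOnly_ret_none G _

theorem blockSearch_time_aux (t start fuel k : ℕ) :
    ∀ x ∈ ((blockSearch P i t start fuel k).exec G).support, x.2 = 0 ∨
      (x.2 : ℝ) ≤ (8 * t + 60) * (√2 + 1) * (√2 * √(searchedLength start x.1) - √2 ^ k) := by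
  have hsqrt : ∀ k : ℕ, √((2 : ℝ) ^ k) = √2 ^ k := fun k => by
    rw [Real.sqrt_eq_iff_mul_self_eq (by positivity) (by positivity), ← mul_pow, sqrt_two_bounds.2]
  have hA : (0 : ℝ) ≤ (8 * t + 60) * (√2 + 1) := by positivity
  have hstep : ∀ k : ℕ, (8 * (t : ℝ) + 60) * √2 ^ k =
      (8 * t + 60) * (√2 + 1) * (√2 * √2 ^ k - √2 ^ k) := fun k => by
    linear_combination (-(8 * (t : ℝ) + 60) * √2 ^ k) * sqrt_two_bounds.2
  induction fuel generalizing k with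
  | zero =>
    intro x hx
    rw [blockSearch, Prog.mem_support_ret] at hx
    simp [hx]
  | succ fuel ih =>
    intro x hx
    rw [blockSearch] at hx
    split_ifs at hx with h
    · right
      have hpos : 1 ≤ 2 ^ k := Nat.one_le_two_pow
      have hlen : (2 : ℝ) ^ k ≤ searchedLength start x.1 := by
        cases hx1 : x.1 with
        | none =>
          have : 2 ^ k + start ≤ d i := by omega
          have : (2 : ℝ) ^ k + start ≤ d i := by exact_mod_cast this
          simp only [searchedLength]
          linarith
        | some z =>
          have hz : start + 2 ^ k - 1 ≤ z.1 :=
            (blockSearch_findsOnly G P t start (fuel + 1) k x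
              (by rw [blockSearch, if_pos h]; exact hx) z hx1).1.1
          have : 2 ^ k + start ≤ z.1 + 1 := by omega
          have : (2 : ℝ) ^ k + start ≤ z.1 + 1 := by exact_mod_cast this
          simp only [searchedLength]
          linarith
      have hlen' : √2 ^ k ≤ √(searchedLength start x.1) := by
        rw [← hsqrt]
        exact Real.sqrt_le_sqrt hlen
      have hfirst : (8 * (t : ℝ) + 60) * √2 ^ k ≤
          (8 * t + 60) * (√2 + 1) * (√2 * √(searchedLength start x.1) - √2 ^ k) := by
        rw [hstep]
        gcongr
      rcases Prog.mem_support_orElse G hx with ⟨-, -, hx⟩ | ⟨u, hu, y, hy, rfl⟩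
      · exact (firstIn_time G P k t _ x hx).trans hfirst
      · have h1 := firstIn_time G P k t _ _ hu
        push_cast
        rcases ih (k + 1) y hy with h0 | h2
        · rw [h0, Nat.cast_zero, add_zero]
          exact h1.trans hfirst
        · rw [hstep] at h1
          rw [pow_succ] at h2
          simp only at h1 h2 ⊢
          linarith
    · rw [Prog.mem_support_ret] at hx
      simp [hx]

theorem blockSearch_time (t start fuel : ℕ) :
    ∀ x ∈ ((blockSearch P i t start fuel 0).exec G).support,
      (x.2 : ℝ) ≤ 4 * (8 * t + 60) * √(searchedLength start x.1) := by
  intro x hx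
  have h1 : √2 ≤ 2 := Real.sqrt_le_iff.2 ⟨by norm_num, by norm_num⟩
  have h2 := sqrt_two_bounds.2
  have hs := Real.sqrt_nonneg (searchedLength start x.1)
  rcases blockSearch_time_aux G P t start fuel 0 x hx with h | h
  · rw [h, Nat.cast_zero]
    positivity
  · refine h.trans ?_
    rw [pow_zero]
    calc (8 * (t : ℝ) + 60) * (√2 + 1) * (√2 * √(searchedLength start x.1) - 1)
        ≤ (8 * t + 60) * (√2 + 1) * (√2 * √(searchedLength start x.1)) := by
          gcongr
          linarith
      _ = (8 * t + 60) * ((√2 * √2 + √2) * √(searchedLength start x.1)) := by ring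
      _ ≤ (8 * t + 60) * (4 * √(searchedLength start x.1)) := by
          gcongr
          linarith
      _ = _ := by ring

theorem blockSearch_errorProb_le (t start fuel k : ℕ) (hfuel : d i ≤ fuel + k) :
    (blockSearch P i t start fuel k).errorProb G (IsFirstIn G P i (start + 2 ^ k - 1) (d i)) ≤
      2 * (3 / 4) ^ t := by
  have hlt : k < 2 ^ k := Nat.lt_two_pow_self
  induction fuel generalizing k with
  | zero =>
    refine (Prog.errorProb_ret G ⟨by simp, fun _ y hy => ?_⟩).le.trans zero_le
    have := y.2
    omega
  | succ fuel ih =>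
    rw [blockSearch]
    split_ifs with h
    · have hnext : start + 2 ^ k - 1 + 2 ^ k = start + 2 ^ (k + 1) - 1 := by
        rw [pow_succ]
        omega
      by_cases hex : ∃ j : Fin (d i), (start + 2 ^ k - 1 ≤ j.1 ∧ j.1 < start + 2 ^ k - 1 + 2 ^ k) ∧
          P (G.nbr i j)
      · refine (Prog.errorProb_bind_le_add G _ _ _ _ (δ := 0) fun o ho => ?_).trans
          ((zero_add _).trans_le (firstIn_errorProb_le G P k t _))
        obtain ⟨j, hj, hP⟩ := hex
        cases o with
        | none => exact absurd hP (ho.of_none rfl j hj.1 hj.2)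
        | some z =>
          refine (Prog.errorProb_ret G ⟨fun w hw => ?_, by simp⟩).le
          obtain ⟨h1, h2⟩ := ho.of_some w hw
          exact ⟨⟨h1.1, w.2⟩, h2⟩
      · have hn : ∀ y : Fin (d i), start + 2 ^ k - 1 ≤ y.1 → y.1 < start + 2 ^ k - 1 + 2 ^ k →
            ¬ P (G.nbr i y) := fun y h1 h2 h3 => hex ⟨y, ⟨h1, h2⟩, h3⟩
        refine (Prog.errorProb_bind_le_add G _ _ (fun o => o = none) _
          (δ := 2 * (3 / 4) ^ t) fun o ho => ?_).trans ?_
        · subst ho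
          refine (Prog.errorProb_mono G _ fun o ho => ?_).trans
            (ih (k + 1) (by omega) Nat.lt_two_pow_self)
          rw [← hnext] at ho
          exact IsFirstIn.of_split_none hn ho (Nat.le_add_right _ _)
        · rw [errorProb_eq_none_of_forall_not G P (firstIn_findsOnly G P k t _) hn, add_zero]
    · refine (Prog.errorProb_ret G ⟨by simp, fun _ y hy => ?_⟩).le.trans zero_le
      have := y.2
      omega

end FirstOne

/-- The implementation of the first-one search. -/
noncomputable def quantumFirstOne : FirstOneSearch := fun n d visited i start =>
  haveI : NeZero n := ⟨i.pos.ne'⟩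
  if numNonSinks d ≤ 1 then .ret none
  else blockSearch (fun v => v ∉ visited ∧ 0 < d v) i (24 * Nat.clog 2 (numNonSinks d)) start (d i) 0

section Bounds

variable {n : ℕ} {d : Fin n → ℕ} (G : AdjDAG n d) (visited : Finset (Fin n)) (i : Fin n)
  (start : ℕ)

theorem quantumFirstOne_of_le_one (h : numNonSinks d ≤ 1) :
    quantumFirstOne n d visited i start = .ret none := by
  rw [quantumFirstOne, if_pos h]

theorem quantumFirstOne_sound : ∀ x ∈ ((quantumFirstOne n d visited i start).exec G).support,
    ∀ z, x.1 = some z → start ≤ z.1 ∧ G.nbr i z ∉ visited ∧ 0 < d (G.nbr i z) := by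
  intro x hx z hz
  have : NeZero n := ⟨i.pos.ne'⟩
  rw [quantumFirstOne] at hx
  split_ifs at hx with h
  · rw [Prog.mem_support_ret] at hx
    simp [hx] at hz
  · obtain ⟨h1, h2⟩ := blockSearch_findsOnly G _ _ _ _ _ x hx z hz
    exact ⟨by simpa using h1.1, h2⟩

theorem clog_two_le {N : ℕ} (hN : 2 ≤ N) : (Nat.clog 2 N : ℝ) ≤ 3 * Real.log N := by
  have hN' : (2 : ℝ) ≤ N := by exact_mod_cast hN
  have h1 : 2 ^ (Nat.clog 2 N).pred < N := Nat.pow_pred_clog_lt_self (by norm_num) (by omega)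
  have h2 : (2 : ℝ) ^ (Nat.clog 2 N - 1) ≤ N := by exact_mod_cast h1.le
  have h3 := Real.log_le_log (by positivity) h2
  have h4 := Real.log_le_log (by norm_num) hN'
  have h5 := Real.log_two_gt_d9
  have h6 : 1 ≤ Nat.clog 2 N := Nat.clog_pos (by norm_num) hN
  rw [Real.log_pow, Nat.cast_sub h6, Nat.cast_one] at h3
  nlinarith

theorem quantumFirstOne_time : ∀ x ∈ ((quantumFirstOne n d visited i start).exec G).support,
    (x.2 : ℝ) ≤ 3024 * √(searchedLength start x.1) * Real.log (numNonSinks d) := by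
  intro x hx
  have : NeZero n := ⟨i.pos.ne'⟩
  rw [quantumFirstOne] at hx
  split_ifs at hx with h
  · rw [Prog.mem_support_ret] at hx
    subst hx
    simp only [Nat.cast_zero]
    have : (0 : ℝ) ≤ Real.log (numNonSinks d) := Real.log_natCast_nonneg _
    positivity
  · have h1 := blockSearch_time G _ _ _ _ x hx
    have h2 := clog_two_le (N := numNonSinks d) (by omega)
    have h3 : (1 : ℝ) ≤ Nat.clog 2 (numNonSinks d) := by
      exact_mod_cast Nat.clog_pos (by norm_num) (by omega)
    refine h1.trans ?_
    rw [mul_right_comm (3024 : ℝ)]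
    push_cast
    refine mul_le_mul_of_nonneg_right ?_ (Real.sqrt_nonneg _)
    linarith

theorem quantumFirstOne_errorProb_le (h : 2 ≤ numNonSinks d) :
    (quantumFirstOne n d visited i start).errorProb G (fun o => o = G.firstOne visited i start) ≤
      1 / (32 * (numNonSinks d : ℝ≥0∞) ^ 2) := by
  have : NeZero n := ⟨i.pos.ne'⟩
  rw [quantumFirstOne, if_neg (by omega)]
  have hb := blockSearch_errorProb_le G (fun v => v ∉ visited ∧ 0 < d v) (i := i)
    (24 * Nat.clog 2 (numNonSinks d)) start (d i) 0 (by omega)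
  rw [pow_zero, Nat.add_sub_cancel] at hb
  refine (Prog.errorProb_mono G _ fun o ho => ?_).trans (hb.trans ?_)
  · exact ho.unique (firstOne_isFirstIn G visited i start)
  · set N := numNonSinks d
    set L := Nat.clog 2 N with hL
    have hN : (N : ℝ) ≤ 2 ^ L := by exact_mod_cast Nat.le_pow_clog (by norm_num) N
    have hL1 : 1 ≤ L := Nat.clog_pos (by norm_num) h
    have h64 : (64 : ℝ) ≤ 64 ^ L := le_self_pow₀ (by norm_num) (by omega)
    have hreal : 2 * (3 / 4 : ℝ) ^ (24 * L) * (32 * (N : ℝ) ^ 2) ≤ 1 := by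
      calc 2 * (3 / 4 : ℝ) ^ (24 * L) * (32 * (N : ℝ) ^ 2)
          = 64 * ((3 / 4) ^ 24) ^ L * (N : ℝ) ^ 2 := by rw [pow_mul]; ring
        _ ≤ 64 ^ L * (1 / 256) ^ L * (2 ^ L) ^ 2 := by
            gcongr
            norm_num
        _ = 1 := by
            rw [← pow_mul, mul_comm L, pow_mul, ← mul_pow, ← mul_pow]
            norm_num
    rw [ENNReal.le_div_iff_mul_le (.inl (by simp; omega)) (.inl (by finiteness)),
      ← ENNReal.toReal_le_toReal (by finiteness) (by finiteness)]
    simpa using hreal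

theorem quantumFirstOne_isCorrect : quantumFirstOne.IsCorrect 3024 where
  sound _ _ G visited i start := quantumFirstOne_sound G visited i start
  time _ _ G visited i start := quantumFirstOne_time G visited i start
  error n d G visited i start := by
    by_cases h : 2 ≤ numNonSinks d
    · refine (quantumFirstOne_errorProb_le G visited i start h).trans ?_
      refine ENNReal.div_le_div_left ?_ _
      exact le_mul_of_one_le_left' (by norm_num)
    · refine (Prog.errorProb_le_one G _ _).trans ?_
      obtain h | h : numNonSinks d = 0 ∨ numNonSinks d = 1 := by omega
      · simp [h]
      · simp [h]

end Bounds

/-! ### The topological sort -/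

section Graph

variable {n : ℕ} {d : Fin n → ℕ} (G : AdjDAG n d)

theorem AdjDAG.not_transGen_self (v : Fin n) : ¬ Relation.TransGen G.Edge v v := G.acyclic v

open Classical in
/-- The number of proper descendants of `v`. -/
noncomputable def AdjDAG.height (v : Fin n) : ℕ :=
  (Finset.univ.filter fun w => Relation.TransGen G.Edge v w).card

theorem AdjDAG.height_lt_of_edge {u v : Fin n} (h : G.Edge u v) : G.height v < G.height u := by
  classical
  refine Finset.card_lt_card (Finset.ssubset_iff_of_subset (fun w hw => ?_) |>.2 ⟨v, ?_, ?_⟩)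
  · rw [Finset.mem_filter] at hw ⊢
    exact ⟨hw.1, .head h hw.2⟩
  · exact Finset.mem_filter.2 ⟨Finset.mem_univ _, .single h⟩
  · exact fun hv => G.not_transGen_self v (Finset.mem_filter.1 hv).2

theorem AdjDAG.height_lt (v : Fin n) : G.height v < n := by
  classical
  have : (Finset.univ.filter fun w => Relation.TransGen G.Edge v w).card <
      (Finset.univ : Finset (Fin n)).card := by
    refine Finset.card_lt_card ((Finset.filter_ssubset).2 ⟨v, Finset.mem_univ _, ?_⟩)
    exact G.not_transGen_self v
  simpa [AdjDAG.height] using this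

theorem AdjDAG.pos_of_edge {u v : Fin n} (h : G.Edge u v) : 0 < d u := by
  obtain ⟨j, -⟩ := h
  exact j.pos

theorem AdjDAG.numEdges_eq_sum : G.numEdges = ∑ i, d i := by
  have h : (Finset.univ.filter fun e : Fin n × Fin n => G.Edge e.1 e.2) =
      (Finset.univ : Finset ((i : Fin n) × Fin (d i))).map
        ⟨fun p => (p.1, G.nbr p.1 p.2), fun p q hpq => by
          obtain ⟨i, j⟩ := p
          obtain ⟨i', j'⟩ := q
          simp only [Prod.mk.injEq] at hpq
          obtain ⟨rfl, h⟩ := hpq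
          rw [G.nbr_injective i h]⟩ := by
    ext ⟨u, v⟩
    simp only [Finset.mem_filter, Finset.mem_univ, true_and, Finset.mem_map]
    constructor
    · rintro ⟨j, rfl⟩
      exact ⟨⟨u, j⟩, rfl⟩
    · rintro ⟨⟨i, j⟩, h⟩
      obtain ⟨rfl, rfl⟩ := Prod.mk.inj h
      exact ⟨j, rfl⟩
  rw [AdjDAG.numEdges, h, Finset.card_map, Finset.card_univ, Fintype.card_sigma]
  simp

theorem mem_sinks {v : Fin n} : v ∈ sinks d ↔ d v = 0 := by
  simp [sinks]

theorem nodup_sinks : (sinks d).Nodup := (List.nodup_finRange n).filter _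

theorem numNonSinks_eq_card : numNonSinks d = (Finset.univ.filter fun v => 0 < d v).card := by
  have h1 : (sinks d).length = (Finset.univ.filter fun v => d v = 0).card := by
    rw [← List.toFinset_card_of_nodup nodup_sinks]
    congr 1
    ext v
    simp [mem_sinks]
  have h2 := Finset.card_filter_add_card_filter_not (s := Finset.univ) fun v => d v = 0
  rw [Finset.card_univ, Fintype.card_fin] at h2
  have h3 : (Finset.univ.filter fun v => 0 < d v).card =
      (Finset.univ.filter fun v => ¬ d v = 0).card :=
    congrArg _ (Finset.filter_congr fun v _ => Nat.pos_iff_ne_zero)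
  rw [numNonSinks, h1, h3]
  omega

theorem AdjDAG.numNonSinks_le_numEdges : numNonSinks d ≤ G.numEdges := by
  rw [G.numEdges_eq_sum, numNonSinks_eq_card, Finset.card_filter]
  refine Finset.sum_le_sum fun v _ => ?_
  split_ifs <;> omega

end Graph

section Time

variable {n : ℕ} {d : Fin n → ℕ} (G : AdjDAG n d) (fos : FirstOneSearch) (a b : ℝ)

/-- The budget of a set of vertices: `a * d v + 2 * b` for each vertex `v` that is not a sink. -/
noncomputable def budget (d : Fin n → ℕ) (a b : ℝ) (V : Finset (Fin n)) : ℝ :=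
  ∑ v ∈ V, if 0 < d v then a * d v + 2 * b else 0

variable {a b} (ha : 0 ≤ a) (hb : 0 ≤ b)
  (hsound : ∀ visited i start, ∀ x ∈ ((fos n d visited i start).exec G).support,
    ∀ z, x.1 = some z → start ≤ z.1 ∧ G.nbr i z ∉ visited ∧ 0 < d (G.nbr i z))
  (htime : ∀ visited i start, start ≤ d i → ∀ x ∈ ((fos n d visited i start).exec G).support,
    (x.2 : ℝ) + (if x.1.isSome then 1 else 0) ≤ a * searchedLength start x.1 + b)

include ha hb hsound htime

theorem searchLoop_time {recurse : Fin n → SortState n → Prog d (SortState n)} {i : Fin n}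
    (hrec : ∀ v s, G.Edge i v → 0 < d v → v ∉ s.visited →
      ∀ x ∈ ((recurse v s).exec G).support,
        (x.2 : ℝ) ≤ budget d a b x.1.visited - budget d a b s.visited - b)
    (fuel start : ℕ) (s : SortState n) (hstart : start ≤ d i) :
    ∀ x ∈ ((searchLoop fos d recurse i fuel start s).exec G).support,
      (x.2 : ℝ) ≤ a * ((d i : ℝ) - start) + b +
        (budget d a b x.1.visited - budget d a b s.visited) := by
  induction fuel generalizing start s with
  | zero =>
    intro x hx
    rw [searchLoop, Prog.mem_support_ret] at hx
    subst hx
    have : (start : ℝ) ≤ d i := by exact_mod_cast hstart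
    have := mul_nonneg ha (sub_nonneg.2 this)
    simp only [Nat.cast_zero, sub_self]
    linarith
  | succ fuel ih =>
    intro x hx
    rw [searchLoop, Prog.mem_support_bind] at hx
    obtain ⟨⟨o, q⟩, hy, w, hw, rfl⟩ := hx
    have ht := htime s.visited i start hstart _ hy
    cases o with
    | none =>
      rw [Prog.mem_support_ret] at hw
      subst hw
      simpa [searchedLength] using ht
    | some z =>
      obtain ⟨h1, h2, h3⟩ := hsound s.visited i start _ hy z rfl
      rw [Prog.mem_support_read] at hw
      obtain ⟨w, hw, rfl⟩ := hw
      rw [Prog.mem_support_bind] at hw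
      obtain ⟨y, hy', w, hw, rfl⟩ := hw
      have h4 := hrec _ s ⟨z, rfl⟩ h3 h2 y hy'
      have h5 := ih (z.1 + 1) y.1 z.2 w hw
      simp only [searchedLength, Option.isSome_some, if_true] at ht
      push_cast at h5 ⊢
      linarith

theorem topSortDFS_time (fuel : ℕ) (i : Fin n) (s : SortState n) (hfuel : G.height i < fuel)
    (hi : i ∉ s.visited) :
    ∀ x ∈ ((topSortDFS fos d fuel i s).exec G).support,
      (x.2 : ℝ) ≤ budget d a b x.1.visited - budget d a b s.visited -
        (if 0 < d i then b else 0) := by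
  induction fuel generalizing i s with
  | zero => omega
  | succ fuel ih =>
    intro x hx
    have hins : budget d a b (insert i s.visited) =
        (if 0 < d i then a * d i + 2 * b else 0) + budget d a b s.visited :=
      Finset.sum_insert hi
    rw [topSortDFS] at hx
    split_ifs at hx with h
    · rw [Prog.mem_support_bind] at hx
      obtain ⟨y, hy, w, hw, rfl⟩ := hx
      rw [Prog.mem_support_ret] at hw
      subst hw
      have := searchLoop_time G fos ha hb hsound htime (recurse := topSortDFS fos d fuel) (i := i)
        (fun v s hv hdv hvs x hx => by
          have := ih v s (by have := G.height_lt_of_edge hv; omega) hvs x hx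
          rwa [if_pos hdv] at this) _ 0 _ (Nat.zero_le _) y hy
      rw [if_pos h] at hins ⊢
      simp only [hins, add_zero, Nat.cast_zero, sub_zero] at this ⊢
      linarith
    · rw [Prog.mem_support_ret] at hx
      subst hx
      rw [if_neg h] at hins ⊢
      simp [hins]

theorem sourceLoop_time (l : List (Fin n)) (s : SortState n) :
    ∀ x ∈ ((sourceLoop fos d l s).exec G).support,
      (x.2 : ℝ) ≤ budget d a b x.1.visited - budget d a b s.visited := by
  induction l generalizing s with
  | nil =>
    intro x hx
    rw [sourceLoop, Prog.mem_support_ret] at hx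
    simp [hx]
  | cons i l ih =>
    intro x hx
    rw [sourceLoop] at hx
    split_ifs at hx with h
    · exact ih s x hx
    · rw [Prog.mem_support_bind] at hx
      obtain ⟨y, hy, w, hw, rfl⟩ := hx
      have h1 := topSortDFS_time G fos ha hb hsound htime n i s (G.height_lt i) h y hy
      have h2 := ih y.1 w hw
      have h3 : (0 : ℝ) ≤ if 0 < d i then b else 0 := by split_ifs <;> simp [hb]
      push_cast
      linarith

theorem topSort_time (l : List (Fin n)) :
    ∀ x ∈ ((topSort fos d l).exec G).support,
      (x.2 : ℝ) ≤ a * G.numEdges + 2 * b * numNonSinks d := by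
  intro x hx
  rw [topSort, Prog.mem_support_bind] at hx
  obtain ⟨y, hy, w, hw, rfl⟩ := hx
  rw [Prog.mem_support_ret] at hw
  subst hw
  have h1 := sourceLoop_time G fos ha hb hsound htime l _ y hy
  have h2 : budget d a b y.1.visited ≤ budget d a b Finset.univ :=
    Finset.sum_le_sum_of_subset_of_nonneg (Finset.subset_univ _) fun v _ _ => by
      split_ifs <;> positivity
  have h3 : budget d a b Finset.univ = a * G.numEdges + 2 * b * numNonSinks d := by
    rw [budget, G.numEdges_eq_sum, numNonSinks_eq_card, Finset.card_filter]
    push_cast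
    rw [Finset.mul_sum, Finset.mul_sum, ← Finset.sum_add_distrib]
    refine Finset.sum_congr rfl fun v _ => ?_
    split_ifs with h
    · ring
    · have : d v = 0 := by omega
      simp [this]
  have h4 : budget d a b ∅ = 0 := Finset.sum_empty
  simp only [add_zero] at h1 ⊢
  linarith

end Time

section Order

variable {n : ℕ} {d : Fin n → ℕ} (G : AdjDAG n d)

/-- `l` is a list of vertices that are not sinks, without repetitions, in which every vertex is
followed by all its out-neighbours that are not sinks. -/
def AdjDAG.IsClosedOrder : List (Fin n) → Prop
  | [] => True
  | i :: l => i ∉ l ∧ 0 < d i ∧ (∀ v, G.Edge i v → 0 < d v → v ∈ l) ∧ AdjDAG.IsClosedOrder l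

variable {G}

theorem AdjDAG.IsClosedOrder.nodup {l : List (Fin n)} (h : G.IsClosedOrder l) : l.Nodup := by
  induction l with
  | nil => exact List.nodup_nil
  | cons i l ih => exact List.nodup_cons.2 ⟨h.1, ih h.2.2.2⟩

theorem AdjDAG.IsClosedOrder.pos {l : List (Fin n)} (h : G.IsClosedOrder l) :
    ∀ v ∈ l, 0 < d v := by
  induction l with
  | nil => simp
  | cons i l ih =>
    intro v hv
    rcases List.mem_cons.1 hv with rfl | hv
    · exact h.2.1
    · exact ih h.2.2.2 v hv

theorem AdjDAG.IsClosedOrder.edge {l : List (Fin n)} (h : G.IsClosedOrder l) {u v : Fin n}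
    (hu : u ∈ l) (huv : G.Edge u v) (hv : 0 < d v) : v ∈ l ∧ l.idxOf u < l.idxOf v := by
  induction l with
  | nil => simp at hu
  | cons i l ih =>
    obtain ⟨h1, h2, h3, h4⟩ := h
    rcases List.mem_cons.1 hu with rfl | hu
    · have hvl := h3 v huv hv
      have hne : u ≠ v := fun h => h1 (h ▸ hvl)
      refine ⟨List.mem_cons_of_mem _ hvl, ?_⟩
      rw [List.idxOf_cons_self, List.idxOf_cons_ne _ hne]
      omega
    · obtain ⟨hvl, hlt⟩ := ih h4 hu
      have hne : i ≠ v := fun h => h1 (h ▸ hvl)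
      have hne' : i ≠ u := fun h => h1 (h ▸ hu)
      refine ⟨List.mem_cons_of_mem _ hvl, ?_⟩
      rw [List.idxOf_cons_ne _ hne, List.idxOf_cons_ne _ hne']
      omega

theorem AdjDAG.IsClosedOrder.mem_of_sources {l : List (Fin n)} (h : G.IsClosedOrder l)
    (hl : ∀ v ∈ G.sources, 0 < d v → v ∈ l) (v : Fin n) (hv : 0 < d v) : v ∈ l := by
  have : IsTrans (Fin n) (Relation.TransGen G.Edge) := inferInstance
  have : Std.Irrefl (Relation.TransGen G.Edge) := ⟨G.not_transGen_self⟩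
  have hwf : WellFounded (Relation.TransGen G.Edge) :=
    Finite.wellFounded_of_trans_of_irrefl _
  induction v using hwf.induction with
  | _ v ih =>
    by_cases hs : ∃ u, G.Edge u v
    · obtain ⟨u, hu⟩ := hs
      exact (h.edge (ih u (.single hu) (G.pos_of_edge hu)) hu hv).1
    · refine hl v ?_ hv
      simpa [AdjDAG.sources] using hs

theorem AdjDAG.IsClosedOrder.isOrderedBy {l : List (Fin n)} (h : G.IsClosedOrder l)
    (hl : ∀ v, 0 < d v → v ∈ l) : G.IsOrderedBy (l ++ sinks d) := by
  have hmem : ∀ v, v ∈ l ↔ 0 < d v := fun v => ⟨h.pos v, hl v⟩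
  have hlen : l.length = numNonSinks d := by
    rw [numNonSinks_eq_card, ← List.toFinset_card_of_nodup h.nodup]
    congr 1
    ext v
    simp [hmem]
  refine ⟨?_, fun u v huv => ?_, fun r hr hle => ?_⟩
  · refine (List.perm_ext_iff_of_nodup ?_ (List.nodup_finRange n)).2 fun v => ?_
    · refine h.nodup.append nodup_sinks fun v hv hv' => ?_
      rw [mem_sinks] at hv'
      have := h.pos v hv
      omega
    · simp only [List.mem_append, hmem, mem_sinks, List.mem_finRange, iff_true]
      omega
  · have hu : u ∈ l := hl u (G.pos_of_edge huv)
    rw [List.idxOf_append_of_mem hu]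
    by_cases hv : 0 < d v
    · obtain ⟨hvl, hlt⟩ := h.edge hu huv hv
      rwa [List.idxOf_append_of_mem hvl]
    · rw [List.idxOf_append_of_notMem fun hvl => hv (h.pos v hvl)]
      have := List.idxOf_lt_length_iff.2 hu
      omega
  · rw [List.getElem_append_right (by omega), ← mem_sinks]
    exact List.getElem_mem _

variable (G)

/-- The invariant of the depth-first search while the vertices in `A` are being processed. -/
structure AdjDAG.SearchInv (A : Finset (Fin n)) (s : SortState n) : Prop where
  visited_iff : ∀ v, 0 < d v → (v ∈ s.visited ↔ v ∈ s.order ∨ v ∈ A)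
  closed : G.IsClosedOrder s.order
  disjoint : ∀ v ∈ A, v ∉ s.order

/-- The number of vertices in `V` that are not sinks. -/
def nonSinkCount (d : Fin n → ℕ) (V : Finset (Fin n)) : ℕ := (V.filter fun v => 0 < d v).card

end Order

section Error

variable {n : ℕ} {d : Fin n → ℕ} (G : AdjDAG n d) (fos : FirstOneSearch) {ε : ℝ≥0∞}
  (herr : ∀ visited i start, i ∈ visited → 0 < d i →
    (fos n d visited i start).errorProb G (fun o => o = G.firstOne visited i start) ≤ ε)

theorem Prog.errorProb_bind_eq_le {α β : Type} {p : Prog d α} {f : α → Prog d β} {a : α} {b : β}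
    {x y : ℝ≥0∞} (hp : p.errorProb G (fun a' => a' = a) ≤ x)
    (hf : (f a).errorProb G (fun b' => b' = b) ≤ y) :
    (p.bind f).errorProb G (fun b' => b' = b) ≤ x + y := by
  refine (Prog.errorProb_bind_le_add G p f (fun a' => a' = a) _ (δ := y) ?_).trans ?_
  · rintro _ rfl
    exact hf
  · rw [add_comm]
    exact add_le_add hp le_rfl

theorem Prog.errorProb_ret_eq {α : Type} (a : α) :
    (Prog.ret a : Prog d α).errorProb G (fun b => b = a) = 0 :=
  Prog.errorProb_ret G rfl

include herr

theorem searchLoop_errorProb {recurse : Fin n → SortState n → Prog d (SortState n)} {i : Fin n}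
    {A : Finset (Fin n)}
    (hrec : ∀ v s, G.Edge i v → 0 < d v → v ∉ s.visited → G.SearchInv A s →
      ∃ s' : SortState n, ∃ k : ℕ, (recurse v s).errorProb G (fun t => t = s') ≤ k * ε ∧
        k + 2 * nonSinkCount d s.visited + 1 ≤ 2 * nonSinkCount d s'.visited ∧
        G.SearchInv A s' ∧ s.visited ⊆ s'.visited ∧ v ∈ s'.visited)
    (hdi : 0 < d i) (fuel start : ℕ) (s : SortState n) (hfuel : d i + 1 ≤ fuel + start)
    (hstart : start ≤ d i) (hi : i ∈ s.visited) (hinv : G.SearchInv A s)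
    (hbefore : ∀ j : Fin (d i), j.1 < start → 0 < d (G.nbr i j) → G.nbr i j ∈ s.visited) :
    ∃ s' : SortState n, ∃ k : ℕ,
      (searchLoop fos d recurse i fuel start s).errorProb G (fun t => t = s') ≤ k * ε ∧
      k + 2 * nonSinkCount d s.visited ≤ 2 * nonSinkCount d s'.visited + 1 ∧
      G.SearchInv A s' ∧ s.visited ⊆ s'.visited ∧
      ∀ j : Fin (d i), 0 < d (G.nbr i j) → G.nbr i j ∈ s'.visited := by
  induction fuel generalizing start s with
  | zero => omega
  | succ fuel ih =>
    have hfirst := firstOne_isFirstIn G s.visited i start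
    have he := herr s.visited i start hi hdi
    cases ho : G.firstOne s.visited i start with
    | none =>
      rw [ho] at hfirst he
      refine ⟨s, 1, ?_, by omega, hinv, Finset.Subset.refl _, fun j hj => ?_⟩
      · rw [searchLoop]
        refine (Prog.errorProb_bind_eq_le G (y := 0) he ?_).trans (by simp)
        exact (Prog.errorProb_ret_eq G _).le
      · by_cases hlt : j.1 < start
        · exact hbefore j hlt hj
        · by_contra hv
          exact hfirst.of_none rfl j (not_lt.1 hlt) j.2 ⟨hv, hj⟩
    | some z =>
      rw [ho] at hfirst he
      obtain ⟨hz, ⟨hzv, hdz⟩, hmin⟩ := hfirst.of_some z rfl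
      obtain ⟨s₁, k₁, he₁, hk₁, hinv₁, hsub₁, hv₁⟩ := hrec _ s ⟨z, rfl⟩ hdz hzv hinv
      obtain ⟨s₂, k₂, he₂, hk₂, hinv₂, hsub₂, hv₂⟩ := ih (z.1 + 1) s₁ (by omega) z.2 (hsub₁ hi)
        hinv₁ fun j hj hdj => by
          rcases Nat.lt_succ_iff_lt_or_eq.1 hj with hlt | heq
          · by_cases hlt' : j.1 < start
            · exact hsub₁ (hbefore j hlt' hdj)
            · by_contra hv
              exact hmin j (not_lt.1 hlt') hlt ⟨fun h => hv (hsub₁ h), hdj⟩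
          · rw [Fin.ext heq]
            exact hv₁
      refine ⟨s₂, 1 + (k₁ + k₂), ?_, by omega, hinv₂, hsub₁.trans hsub₂, hv₂⟩
      rw [searchLoop]
      refine (Prog.errorProb_bind_eq_le G (y := k₁ * ε + k₂ * ε) he ?_).trans (le_of_eq ?_)
      · simp only [Prog.errorProb_read]
        exact Prog.errorProb_bind_eq_le G he₁ he₂
      · push_cast
        ring

theorem topSortDFS_errorProb (fuel : ℕ) (i : Fin n) (s : SortState n) (A : Finset (Fin n))
    (hfuel : G.height i < fuel) (hinv : G.SearchInv A s) (hi : i ∉ s.visited)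
    (hA : ∀ a ∈ A, Relation.TransGen G.Edge a i) :
    ∃ s' : SortState n, ∃ k : ℕ,
      (topSortDFS fos d fuel i s).errorProb G (fun t => t = s') ≤ k * ε ∧
      k + 2 * nonSinkCount d s.visited + (if 0 < d i then 1 else 0) ≤
        2 * nonSinkCount d s'.visited ∧
      G.SearchInv A s' ∧ s.visited ⊆ s'.visited ∧ i ∈ s'.visited := by
  induction fuel generalizing i s A with
  | zero => omega
  | succ fuel ih =>
    rw [topSortDFS]
    by_cases hdi : 0 < d i
    · have hcount : nonSinkCount d (insert i s.visited) = nonSinkCount d s.visited + 1 := by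
        rw [nonSinkCount, Finset.filter_insert, if_pos hdi,
          Finset.card_insert_of_notMem fun h => hi (Finset.mem_filter.1 h).1, nonSinkCount]
      have hiA : i ∉ A := fun h => G.not_transGen_self i (hA i h)
      have hio : i ∉ s.order := fun h => hi ((hinv.visited_iff i hdi).2 (.inl h))
      have hinv₁ : G.SearchInv (insert i A) ⟨insert i s.visited, s.order⟩ := by
        refine ⟨fun v hv => ?_, hinv.closed, fun v hv => ?_⟩
        · simp only [Finset.mem_insert, hinv.visited_iff v hv]
          tauto
        · rcases Finset.mem_insert.1 hv with rfl | hv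
          · exact hio
          · exact hinv.disjoint v hv
      obtain ⟨s', k, he, hk, hinv', hsub, hall⟩ := searchLoop_errorProb G fos herr
        (recurse := topSortDFS fos d fuel) (i := i) (A := insert i A)
        (fun v t hv hdv hvt hinvt => by
          have h := ih v t (insert i A) (by have := G.height_lt_of_edge hv; omega) hinvt hvt
            fun a ha => by
              rcases Finset.mem_insert.1 ha with rfl | ha
              · exact .single hv
              · exact .tail (hA a ha) hv
          rwa [if_pos hdv] at h)
        hdi (d i + 1) 0 ⟨insert i s.visited, s.order⟩ (by omega) (Nat.zero_le _)
        (Finset.mem_insert_self _ _) hinv₁ fun j hj => absurd hj (Nat.not_lt_zero _)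
      have his' : i ∈ s'.visited := hsub (Finset.mem_insert_self _ _)
      refine ⟨⟨s'.visited, i :: s'.order⟩, k, ?_, ?_, ⟨fun v hv => ?_, ⟨?_, hdi, fun v hv hdv => ?_,
        hinv'.closed⟩, fun v hv => ?_⟩, fun v hv => hsub (Finset.mem_insert_of_mem hv), his'⟩
      · simp only [if_pos hdi]
        refine (Prog.errorProb_bind_eq_le G (y := 0) he ?_).trans (by simp)
        exact (Prog.errorProb_ret_eq G _).le
      · rw [if_pos hdi]
        simp only at hk ⊢
        omega
      · rw [hinv'.visited_iff v hv, Finset.mem_insert, List.mem_cons]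
        tauto
      · exact hinv'.disjoint i (Finset.mem_insert_self _ _)
      · obtain ⟨j, rfl⟩ := hv
        refine ((hinv'.visited_iff _ hdv).1 (hall j hdv)).resolve_right fun h => ?_
        rcases Finset.mem_insert.1 h with h | h
        · exact G.not_transGen_self i (.single ⟨j, h⟩)
        · exact G.not_transGen_self i (.head ⟨j, rfl⟩ (hA _ h))
      · rw [List.mem_cons, not_or]
        exact ⟨fun h => hiA (h ▸ hv), hinv'.disjoint v (Finset.mem_insert_of_mem hv)⟩
    · refine ⟨⟨insert i s.visited, s.order⟩, 0, ?_, ?_, ⟨fun v hv => ?_, hinv.closed, hinv.disjoint⟩,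
        Finset.subset_insert _ _, Finset.mem_insert_self _ _⟩
      · simp only [if_neg hdi]
        exact (Prog.errorProb_ret_eq G _).le.trans zero_le
      · simp only [if_neg hdi, nonSinkCount, Finset.filter_insert]
        omega
      · have : v ≠ i := fun h => hdi (h ▸ hv)
        simp [hinv.visited_iff v hv, this]

theorem sourceLoop_errorProb (l : List (Fin n)) (s : SortState n) (hinv : G.SearchInv ∅ s) :
    ∃ s' : SortState n, ∃ k : ℕ,
      (sourceLoop fos d l s).errorProb G (fun t => t = s') ≤ k * ε ∧
      k + 2 * nonSinkCount d s.visited ≤ 2 * nonSinkCount d s'.visited ∧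
      G.SearchInv ∅ s' ∧ s.visited ⊆ s'.visited ∧ ∀ v ∈ l, v ∈ s'.visited := by
  induction l generalizing s with
  | nil =>
    exact ⟨s, 0, (Prog.errorProb_ret_eq G _).le.trans zero_le, by omega, hinv,
      Finset.Subset.refl _, by simp⟩
  | cons i l ih =>
    rw [sourceLoop]
    by_cases h : i ∈ s.visited
    · obtain ⟨s', k, he, hk, hinv', hsub, hall⟩ := ih s hinv
      rw [if_pos h]
      refine ⟨s', k, he, hk, hinv', hsub, fun v hv => ?_⟩
      rcases List.mem_cons.1 hv with rfl | hv
      · exact hsub h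
      · exact hall v hv
    · obtain ⟨s₁, k₁, he₁, hk₁, hinv₁, hsub₁, hv₁⟩ := topSortDFS_errorProb G fos herr n i s ∅
        (G.height_lt i) hinv h (by simp)
      obtain ⟨s₂, k₂, he₂, hk₂, hinv₂, hsub₂, hv₂⟩ := ih s₁ hinv₁
      rw [if_neg h]
      refine ⟨s₂, k₁ + k₂, ?_, by omega, hinv₂, hsub₁.trans hsub₂, fun v hv => ?_⟩
      · refine (Prog.errorProb_bind_eq_le G he₁ he₂).trans (le_of_eq ?_)
        push_cast
        ring
      · rcases List.mem_cons.1 hv with rfl | hv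
        · exact hsub₂ hv₁
        · exact hv₂ v hv

theorem topSort_errorProb_le :
    (topSort fos d G.sources).errorProb G G.IsOrderedBy ≤ 2 * numNonSinks d * ε := by
  obtain ⟨s, k, he, hk, hinv, -, hall⟩ := sourceLoop_errorProb G fos herr G.sources ⟨∅, []⟩
    ⟨by simp, trivial, by simp⟩
  have hk' : k ≤ 2 * numNonSinks d := by
    have : nonSinkCount d s.visited ≤ numNonSinks d := by
      rw [numNonSinks_eq_card]
      exact Finset.card_le_card (Finset.filter_subset_filter _ (Finset.subset_univ _))
    omega
  rw [topSort]
  refine (Prog.errorProb_bind_le_add G _ _ (fun t => t = s) _ (δ := 0) ?_).trans ?_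
  · rintro _ rfl
    refine (Prog.errorProb_ret G ?_).le
    refine hinv.closed.isOrderedBy (hinv.closed.mem_of_sources fun v hv hdv => ?_)
    simpa using (hinv.visited_iff v hdv).1 (hall v hv)
  · rw [zero_add]
    refine he.trans ?_
    gcongr
    exact_mod_cast hk'

end Error

section Main

variable {n : ℕ} {d : Fin n → ℕ} (G : AdjDAG n d)

theorem sqrt_le_of_pos {x N R : ℝ} (hx : 0 ≤ x) (hN : 0 < N) (hR : 0 < R) :
    √x ≤ N / (2 * R) * x + R / (2 * N) := by
  have h := sq_nonneg (√x * N - R)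
  have hs := Real.mul_self_sqrt hx
  rw [div_mul_eq_mul_div, div_add_div _ _ (by positivity) (by positivity),
    le_div_iff₀ (by positivity)]
  have : (√x * N - R) ^ 2 = x * N ^ 2 - 2 * √x * N * R + R ^ 2 := by
    linear_combination N ^ 2 * hs
  nlinarith

theorem topSort_quantumFirstOne_time (l : List (Fin n)) :
    (topSort quantumFirstOne d l).TimeLE G fun _ =>
      5000 * √((numNonSinks d : ℝ) * G.numEdges) * Real.log (numNonSinks d) := by
  intro x hx
  have hsound := quantumFirstOne_sound G
  by_cases hle : numNonSinks d ≤ 1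
  · have h := topSort_time G quantumFirstOne le_rfl le_rfl hsound
      (fun visited i start _ y hy => by
        rw [quantumFirstOne_of_le_one visited i start hle, Prog.mem_support_ret] at hy
        simp [hy]) l x hx
    have hlog : (0 : ℝ) ≤ Real.log (numNonSinks d) := Real.log_natCast_nonneg _
    refine h.trans ?_
    rw [zero_mul, mul_zero, zero_mul, add_zero]
    positivity
  · set N : ℝ := ((numNonSinks d : ℕ) : ℝ) with hNdef
    set m : ℝ := ((G.numEdges : ℕ) : ℝ) with hmdef
    have hN2 : (2 : ℝ) ≤ N := by
      rw [hNdef]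
      exact_mod_cast Nat.lt_of_not_le hle
    have hN : 0 < N := by linarith
    have hNm : N ≤ m := by
      rw [hNdef, hmdef]
      exact_mod_cast G.numNonSinks_le_numEdges
    set R : ℝ := √(N * m) with hRdef
    have hRR : R * R = N * m := Real.mul_self_sqrt (by nlinarith)
    have hNR : N ≤ R := Real.le_sqrt_of_sq_le (by nlinarith)
    have hR : 0 < R := by linarith
    set L : ℝ := Real.log N with hLdef
    have hL : 0.69 ≤ L := by
      have h1 := Real.log_le_log (by norm_num) hN2
      have h2 := Real.log_two_gt_d9
      linarith
    have h := topSort_time G quantumFirstOne (a := 3024 * L * (N / (2 * R)))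
      (b := 3024 * L * (R / (2 * N)) + 1) (by positivity) (by positivity) hsound
      (fun visited i start hstart y hy => by
        have h1 := quantumFirstOne_time G visited i start y hy
        have hlen : 0 ≤ searchedLength start y.1 := by
          cases hy1 : y.1 with
          | none =>
            have : (start : ℝ) ≤ d i := by exact_mod_cast hstart
            simp only [searchedLength]
            linarith
          | some z =>
            have : (start : ℝ) ≤ z.1 := by exact_mod_cast (hsound visited i start y hy z hy1).1
            simp only [searchedLength]
            linarith
        have h2 := mul_le_mul_of_nonneg_left (sqrt_le_of_pos hlen hN hR)
          (show 0 ≤ 3024 * L by positivity)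
        have h3 : (if y.1.isSome then 1 else 0 : ℝ) ≤ 1 := by split_ifs <;> norm_num
        linarith) l x hx
    refine h.trans ?_
    have e1 : 3024 * L * (N / (2 * R)) * m = 1512 * L * R := by
      field_simp
      linear_combination (-3024 : ℝ) * hRR
    have e2 : 2 * (3024 * L * (R / (2 * N)) + 1) * N = 3024 * L * R + 2 * N := by
      field_simp
    rw [e1, e2]
    nlinarith [mul_le_mul_of_nonneg_right hL hR.le]

theorem firstOne_eq_none_of_le_one (h : numNonSinks d ≤ 1) {visited : Finset (Fin n)} {i : Fin n}
    (hi : i ∈ visited) (hdi : 0 < d i) (start : ℕ) : G.firstOne visited i start = none := by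
  cases ho : G.firstOne visited i start with
  | none => rfl
  | some z =>
    obtain ⟨-, ⟨hz, hdz⟩, -⟩ := (firstOne_isFirstIn G visited i start).of_some z ho
    rw [numNonSinks_eq_card, Finset.card_le_one] at h
    have := h i (by simp [hdi]) (G.nbr i z) (by simp [hdz])
    exact absurd (this ▸ hi) hz

theorem topSort_quantumFirstOne_errorProb :
    (topSort quantumFirstOne d G.sources).errorProb G G.IsOrderedBy ≤ 1 / 10 ∧
      (topSort quantumFirstOne d G.sources).errorProb G G.IsOrderedBy ≤
        1 / (numNonSinks d : ℝ≥0∞) := by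
  by_cases hle : numNonSinks d ≤ 1
  · have h := topSort_errorProb_le G quantumFirstOne (ε := 0) fun visited i start hi hdi => by
      rw [quantumFirstOne_of_le_one visited i start hle, firstOne_eq_none_of_le_one G hle hi hdi]
      exact (Prog.errorProb_ret_eq G _).le
    rw [mul_zero] at h
    exact ⟨h.trans zero_le, h.trans zero_le⟩
  · have hN2 : 2 ≤ numNonSinks d := by omega
    have h := topSort_errorProb_le G quantumFirstOne fun visited i start _ _ =>
      quantumFirstOne_errorProb_le G visited i start hN2
    set N := numNonSinks d
    have hN : (2 : ℝ) ≤ N := by exact_mod_cast hN2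
    have hne : (N : ℝ≥0∞) ≠ 0 := by
      simp only [ne_eq, Nat.cast_eq_zero]
      omega
    have hfin : 2 * (N : ℝ≥0∞) * (1 / (32 * (N : ℝ≥0∞) ^ 2)) ≠ ⊤ := by
      refine ENNReal.mul_ne_top (by finiteness) (ENNReal.div_ne_top (by simp) ?_)
      exact mul_ne_zero (by norm_num) (pow_ne_zero _ hne)
    have hval : (2 * (N : ℝ≥0∞) * (1 / (32 * (N : ℝ≥0∞) ^ 2))).toReal = 1 / (16 * (N : ℝ)) := by
      simp only [ENNReal.toReal_mul, ENNReal.toReal_div, ENNReal.toReal_pow,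
        ENNReal.toReal_natCast, ENNReal.toReal_one, ENNReal.toReal_ofNat]
      field_simp
      norm_num
    constructor
    · refine h.trans ?_
      rw [← ENNReal.toReal_le_toReal hfin (ENNReal.div_ne_top (by simp) (by simp)), hval,
        ENNReal.toReal_div, ENNReal.toReal_one, ENNReal.toReal_ofNat]
      gcongr
      linarith
    · refine h.trans ?_
      rw [← ENNReal.toReal_le_toReal hfin (ENNReal.div_ne_top (by simp) hne), hval,
        ENNReal.toReal_div, ENNReal.toReal_one, ENNReal.toReal_natCast]
      gcongr
      linarith

end Main

end QTopSort

theorem lemma1 :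
    ∃ (fos : FirstOneSearch) (c : ℝ), fos.IsCorrect c ∧
      ∃ C : ℝ, ∀ (n : ℕ) (d : Fin n → ℕ) (G : AdjDAG n d),
        (topSort fos d G.sources).TimeLE G (fun _ =>
          C * √((numNonSinks d : ℝ) * G.numEdges) * Real.log (numNonSinks d)) ∧
        (topSort fos d G.sources).errorProb G G.IsOrderedBy ≤ 1 / 10 ∧
        (topSort fos d G.sources).errorProb G G.IsOrderedBy ≤ 1 / (numNonSinks d : ℝ≥0∞) :=
  ⟨quantumFirstOne, 3024, quantumFirstOne_isCorrect, 5000, fun _ _ G =>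
    ⟨topSort_quantumFirstOne_time G G.sources, topSort_quantumFirstOne_errorProb G⟩⟩
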